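/- Let $\mathbf A=\begin{bmatrix}\mathbf A_{11}&\mathbf A_{12}\\ \mathbf A_{21}&\mathbf A_{22}\end{bmatrix}\in\mathbb R^{(n+m)\times(n+m)}$, $\mathbf B\in\mathbb R^{(n+m)\times p}$, $\mathbf W=\mathrm{diag}(\mathbf W_{11},\mathbf W_{22})$ with $\mathbf W_{11},\mathbf W_{22}\succ 0$, a feedback gain $\mathbf K\in\mathbb R^{p\times(n+m)}$ and a sensor gain $\mathbf C_1\in\mathbb R^{n\times n}$ be given. States are $\mathbf x_t=(\mathbf x^1_t,\mathbf x^2_t)\in\mathbb R^n\times\mathbb R^m$ and time is $t=0,1,2,\dots$. Consider two closed loops, each with plant $\mathbf x_{t+1}=\mathbf A\mathbf x_t+\mathbf B\mathbf u_t+\mathbf w_t$, where $\mathbf w_t\sim\mathcal N(\mathbf 0,\mathbf W)$ are IID. (G) Gaussian loop. $\mathbf x^{\mathrm G}_0$ is Gaussian, $\mathbf v_t\sim\mathcal N(\mathbf 0,\mathbf I_n)$ are IID, and $\mathbf x_0^{\mathrm G}$, $\{\mathbf w_t\}$, $\{\mathbf v_t\}$ are mutually independent. The sensor output is $\mathbf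 y_t=\mathbf C_1\mathbf x^{1,\mathrm G}_t+\mathbf v_t$; the estimates are $\tilde{\mathbf x}^{1,\mathrm G}_t=\mathbb E[\mathbf x^{1,\mathrm G}_t\mid \mathbf x^{2,\mathrm G}_{0:t},\mathbf y_{0:t-1}]$ and $\hat{\mathbf x}^{1,\mathrm G}_t=\mathbb E[\mathbf x^{1,\mathrm G}_t\mid \mathbf x^{2,\mathrm G}_{0:t},\mathbf y_{0:t}]$; the control is $\mathbf u_t=\mathbf K(\hat{\mathbf x}^{1,\mathrm G}_t,\mathbf x^{2,\mathrm G}_t)$. Put $\tilde{\mathbf r}^{\mathrm G}_t=\mathbf x^{1,\mathrm G}_t-\tilde{\mathbf x}^{1,\mathrm G}_t$. (NG) Dithered quantizer loop. Let $\Delta=2\sqrt3$, and let $\mathbf q_\Delta$ round each coordinate to an integer multiple of $\Delta$: $[\mathbf q_\Delta(\mathbf z)]_i=k\Delta$ if $[\mathbf z]_i\in[k\Delta-\frac\Delta2,k\Delta+\frac\Delta2)$, $k\in\mathbb Z$. The dither entries $[\mathbf d_t]_i$ are IID over $i$ and $t$, uniform on $[-\frac\Delta2,\frac\Delta2)$,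 the initial state $\mathbf x^{\mathrm{NG}}_0$ is square-integrable, and $\mathbf x^{\mathrm{NG}}_0$, $\{\mathbf w_t\}$, $\{\mathbf d_t\}$ are mutually independent. $\tilde{\mathbf x}^{1,\mathrm{NG}}_t$ is the linear (affine) minimum mean squared error estimate of $\mathbf x^{1,\mathrm{NG}}_t$ given $\mathbf x^{2,\mathrm{NG}}_{0:t},\mathbf y^{\mathrm{NG}}_{0:t-1}$; the quantizer output is $\tilde{\mathbf z}_t=\mathbf q_\Delta(\mathbf C_1(\mathbf x^{1,\mathrm{NG}}_t-\tilde{\mathbf x}^{1,\mathrm{NG}}_t)+\mathbf d_t)$; the decoder forms $\mathbf y^{\mathrm{NG}}_t=\tilde{\mathbf z}_t-\mathbf d_t$; $\hat{\mathbf x}^{1,\mathrm{NG}}_t$ is the linear (affine) minimum mean squared error estimate of $\mathbf x^{1,\mathrm{NG}}_t$ given $\mathbf x^{2,\mathrm{NG}}_{0:t},\mathbf y^{\mathrm{NG}}_{0:t}$; and $\mathbf u_t=\mathbf K(\hat{\mathbf x}^{1,\mathrm{NG}}_t,\mathbf x^{2,\mathrm{NG}}_t)$. If $\mathbf x^{\mathrm{NG}}_0$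 and $\mathbf x^{\mathrm G}_0$ have identical first and second moments, then at every time $t$, with entropy and mutual information in bits, $$H(\tilde{\mathbf z}_t\mid\mathbf d_t)\le\frac n2\log_2\frac{4\pi e}{12}+I\bigl(\mathbf C_1\tilde{\mathbf r}^{\mathrm G}_t;\ \mathbf C_1\tilde{\mathbf r}^{\mathrm G}_t+\mathbf v_t\bigr).$$ -/

import Mathlib

open MeasureTheory ProbabilityTheory
open scoped ENNReal

noncomputable section

namespace DitheredLQG

/-- Column vectors with entries indexed by `ι`, with the Euclidean norm. -/
abbrev Vec (ι : Type) : Type := EuclideanSpace ℝ ι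

/-! ### Information measures, in bits -/

open Classical in
/-- Shannon entropy `∑ₓ -μ{x} log₂ μ{x}` of a discrete probability law, that is, of a law carried
by a countable set. A law that is not discrete is given the value `∞`. -/
def entropyBits {α : Type*} [MeasurableSpace α] (μ : Measure α) : ℝ≥0∞ :=
  if ∃ S : Set α, S.Countable ∧ μ Sᶜ = 0 then
    ∑' x : α, ENNReal.ofReal (Real.negMulLog (μ.real {x}) / Real.log 2)
  else ∞

/-- Conditional entropy `H(Z | D) = ∫ H(law of Z given D = δ) d(law of D)(δ)`. -/
def condEntropyBits {Ω α β : Type*} [MeasurableSpace Ω] [MeasurableSpace α] [StandardBorelSpace α]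
    [Nonempty α] [MeasurableSpace β] (Z : Ω → α) (D : Ω → β) (P : Measure Ω)
    [IsProbabilityMeasure P] : ℝ≥0∞ :=
  ∫⁻ δ, entropyBits (condDistrib Z D P δ) ∂(P.map D)

/-- Mutual information `I(X ; Y)`: the Kullback-Leibler divergence of the joint law from the
product of the marginal laws, converted from nats to bits. -/
def mutualInfoBits {Ω α β : Type*} [MeasurableSpace Ω] [MeasurableSpace α] [MeasurableSpace β]
    (X : Ω → α) (Y : Ω → β) (P : Measure Ω) : ℝ≥0∞ :=
  InformationTheory.klDiv (P.map (fun ω => (X ω, Y ω))) ((P.map X).prod (P.map Y)) /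
    ENNReal.ofReal (Real.log 2)

/-! ### The plant -/

/-- Plant matrices in block form, feedback gain `K` and sensor gain `C₁`. -/
structure System (n m p : ℕ) where
  A₁₁ : Matrix (Fin n) (Fin n) ℝ
  A₁₂ : Matrix (Fin n) (Fin m) ℝ
  A₂₁ : Matrix (Fin m) (Fin n) ℝ
  A₂₂ : Matrix (Fin m) (Fin m) ℝ
  B : Matrix (Fin n ⊕ Fin m) (Fin p) ℝ
  W₁₁ : Matrix (Fin n) (Fin n) ℝ
  W₂₂ : Matrix (Fin m) (Fin m) ℝ
  W₁₁_posDef : W₁₁.PosDef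
  W₂₂_posDef : W₂₂.PosDef
  K : Matrix (Fin p) (Fin n ⊕ Fin m) ℝ
  C₁ : Matrix (Fin n) (Fin n) ℝ

/-- The full system matrix. -/
def System.A {n m p : ℕ} (S : System n m p) : Matrix (Fin n ⊕ Fin m) (Fin n ⊕ Fin m) ℝ :=
  Matrix.fromBlocks S.A₁₁ S.A₁₂ S.A₂₁ S.A₂₂

/-- The block-diagonal covariance of the plant noise. -/
def System.W {n m p : ℕ} (S : System n m p) : Matrix (Fin n ⊕ Fin m) (Fin n ⊕ Fin m) ℝ :=
  Matrix.fromBlocks S.W₁₁ 0 0 S.W₂₂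

/-- Matrix times column vector. -/
def act {ι κ : Type} [Fintype κ] (M : Matrix ι κ ℝ) (v : Vec κ) : Vec ι :=
  WithLp.toLp 2 (M.mulVec (WithLp.ofLp v))

/-- The first block `x¹` of a state. -/
def fstBlock {n m : ℕ} (x : Vec (Fin n ⊕ Fin m)) : Vec (Fin n) :=
  WithLp.toLp 2 (fun i => x (Sum.inl i))

/-- The second block `x²` of a state. -/
def sndBlock {n m : ℕ} (x : Vec (Fin n ⊕ Fin m)) : Vec (Fin m) :=
  WithLp.toLp 2 (fun j => x (Sum.inr j))

/-- The state with blocks `a` and `b`. -/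
def stack {n m : ℕ} (a : Vec (Fin n)) (b : Vec (Fin m)) : Vec (Fin n ⊕ Fin m) :=
  WithLp.toLp 2 (Sum.elim (fun i => a i) (fun j => b j))

/-! ### Observations and estimators. Time runs through `0, 1, 2, …`, time `0` being the first. -/

/-- The data `(y₀, …, yₛ₋₁, x²₀, …, x²ₜ₋₁)`: the first `s` measurements and the first `t` values
of the side information. -/
def observed {Ω : Type*} {n m : ℕ} (y : ℕ → Ω → Vec (Fin n)) (x : ℕ → Ω → Vec (Fin n ⊕ Fin m))
    (s t : ℕ) (ω : Ω) : (Fin s → Vec (Fin n)) × (Fin t → Vec (Fin m)) :=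
  (fun i => y i ω, fun j => sndBlock (x j ω))

/-- `Xhat` is a linear minimum mean squared error estimate of `X` given `Y`: an affine function
of `Y` whose mean squared error is minimal among all affine functions of `Y`. -/
def IsLMMSE {Ω E : Type*} [MeasurableSpace Ω] [AddCommGroup E] [Module ℝ E] {n : ℕ}
    (P : Measure Ω) (X : Ω → Vec (Fin n)) (Y : Ω → E) (Xhat : Ω → Vec (Fin n)) : Prop :=
  (∃ g : E →ᵃ[ℝ] Vec (Fin n), ∀ ω, Xhat ω = g (Y ω)) ∧
  ∀ g : E →ᵃ[ℝ] Vec (Fin n),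
    ∫⁻ ω, ‖X ω - Xhat ω‖ₑ ^ 2 ∂P ≤ ∫⁻ ω, ‖X ω - g (Y ω)‖ₑ ^ 2 ∂P

/-! ### The three-stage linear/Gaussian loop -/

/-- The processes of the three-stage loop: Gaussian plant, sensor `y = C₁ x¹ + v` with
`v ∼ N(0, I)`, Kalman (conditional mean) filter and linear feedback of the estimate. -/
structure GaussianLoop {n m p : ℕ} (S : System n m p) {Ω : Type*} [MeasurableSpace Ω]
    (P : Measure Ω) where
  /-- plant state -/
  x : ℕ → Ω → Vec (Fin n ⊕ Fin m)
  /-- control input -/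
  u : ℕ → Ω → Vec (Fin p)
  /-- plant noise -/
  w : ℕ → Ω → Vec (Fin n ⊕ Fin m)
  /-- sensor noise -/
  v : ℕ → Ω → Vec (Fin n)
  /-- sensor output -/
  y : ℕ → Ω → Vec (Fin n)
  /-- a priori estimate of `x¹`, after the side information has been received -/
  xtil : ℕ → Ω → Vec (Fin n)
  /-- a posteriori estimate of `x¹` -/
  xhat : ℕ → Ω → Vec (Fin n)
  measurable_x_zero : Measurable (x 0)
  measurable_w : ∀ t, Measurable (w t)
  measurable_v : ∀ t, Measurable (v t)
  measurable_xtil : ∀ t, Measurable (xtil t)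
  measurable_xhat : ∀ t, Measurable (xhat t)
  gaussian_x_zero : HasGaussianLaw (x 0) P
  law_w : ∀ t, HasLaw (w t) (multivariateGaussian 0 S.W) P
  law_v : ∀ t, HasLaw (v t) (multivariateGaussian 0 1) P
  indep_w : iIndepFun w P
  indep_v : iIndepFun v P
  indep_x_zero_w : IndepFun (x 0) (fun ω t => w t ω) P
  indep_x_zero_w_v : IndepFun (fun ω => (x 0 ω, fun t => w t ω)) (fun ω t => v t ω) P
  plant : ∀ t ω, x (t + 1) ω = act S.A (x t ω) + act S.B (u t ω) + w t ω
  sensor : ∀ t ω, y t ω = act S.C₁ (fstBlock (x t ω)) + v t ω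
  prior : ∀ t, xtil t =ᵐ[P]
    P[fun ω => fstBlock (x t ω) | MeasurableSpace.comap (observed y x t (t + 1)) inferInstance]
  posterior : ∀ t, xhat t =ᵐ[P]
    P[fun ω => fstBlock (x t ω) |
      MeasurableSpace.comap (observed y x (t + 1) (t + 1)) inferInstance]
  control : ∀ t ω, u t ω = act S.K (stack (xhat t ω) (sndBlock (x t ω)))

/-- The a priori residual `x¹ₜ - E[x¹ₜ | x²₀, …, x²ₜ, y₀, …, yₜ₋₁]`. -/
def GaussianLoop.rtil {n m p : ℕ} {S : System n m p} {Ω : Type*} [MeasurableSpace Ω]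
    {P : Measure Ω} (G : GaussianLoop S P) (t : ℕ) (ω : Ω) : Vec (Fin n) :=
  fstBlock (G.x t ω) - G.xtil t ω

/-! ### The loop with the dithered quantizer -/

/-- Elementwise uniform quantizer: a coordinate in `[kΔ - Δ/2, kΔ + Δ/2)`, `k` an integer, is
sent to `kΔ`. -/
def quantize {ι : Type} (Δ : ℝ) (z : Vec ι) : Vec ι :=
  WithLp.toLp 2 (fun i => (⌊z i / Δ + 1 / 2⌋ : ℝ) * Δ)

/-- The quantizer sensitivity `Δ = 2√3`, for which `Δ² / 12 = 1`. -/
def sens : ℝ := 2 * Real.sqrt 3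

/-- The processes of the loop in which the sensor is replaced by a predictive quantizer with
subtractive dither. -/
structure DitheredLoop {n m p : ℕ} (S : System n m p) {Ω : Type*} [MeasurableSpace Ω]
    (P : Measure Ω) where
  /-- plant state -/
  x : ℕ → Ω → Vec (Fin n ⊕ Fin m)
  /-- control input -/
  u : ℕ → Ω → Vec (Fin p)
  /-- plant noise -/
  w : ℕ → Ω → Vec (Fin n ⊕ Fin m)
  /-- dither -/
  d : ℕ → Ω → Vec (Fin n)
  /-- quantizer output -/
  ztil : ℕ → Ω → Vec (Fin n)
  /-- measurement formed by the decoder -/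
  y : ℕ → Ω → Vec (Fin n)
  /-- a priori estimate of `x¹`, after the side information has been received -/
  xtil : ℕ → Ω → Vec (Fin n)
  /-- a posteriori estimate of `x¹` -/
  xhat : ℕ → Ω → Vec (Fin n)
  measurable_x_zero : Measurable (x 0)
  measurable_w : ∀ t, Measurable (w t)
  measurable_d : ∀ t, Measurable (d t)
  memLp_x_zero : MemLp (x 0) 2 P
  law_w : ∀ t, HasLaw (w t) (multivariateGaussian 0 S.W) P
  law_d : ∀ t i, pdf.IsUniform (fun ω => d t ω i) (Set.Ico (-(sens / 2)) (sens / 2)) P volume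
  indep_w : iIndepFun w P
  indep_d : iIndepFun (fun (ti : ℕ × Fin n) ω => d ti.1 ω ti.2) P
  indep_x_zero_w : IndepFun (x 0) (fun ω t => w t ω) P
  indep_x_zero_w_d : IndepFun (fun ω => (x 0 ω, fun t => w t ω)) (fun ω t => d t ω) P
  plant : ∀ t ω, x (t + 1) ω = act S.A (x t ω) + act S.B (u t ω) + w t ω
  prior : ∀ t, IsLMMSE P (fun ω => fstBlock (x t ω)) (observed y x t (t + 1)) (xtil t)
  quantizer : ∀ t ω,
    ztil t ω = quantize sens (act S.C₁ (fstBlock (x t ω) - xtil t ω) + d t ω)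
  decoder : ∀ t ω, y t ω = ztil t ω - d t ω
  posterior : ∀ t,
    IsLMMSE P (fun ω => fstBlock (x t ω)) (observed y x (t + 1) (t + 1)) (xhat t)
  control : ∀ t ω, u t ω = act S.K (stack (xhat t ω) (sndBlock (x t ω)))

end DitheredLQG

end

/-!
The two loops are compared through second moments; of the dithered loop nothing else is used but the
law of the dither and the fact that the quantizer output lies in a lattice.

*Entropy.* Write `Y = Z - D` for the decoder output of the dithered loop, where `Z` is the
quantizer output and `D` the dither. By Gibbs' inequality on the lattice, applied conditionally on
`D = δ` with the weights `z ↦ Δⁿ g (z - δ)`, where `g` is the density of `N(0, L Lᵀ)`, the entropy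
`H(Z | D)` is at most `-E[log g(Y)] - n log Δ` (`condEntropyBits_le`). The weights have total mass
at most one after averaging over `δ`, because the reflected dither cubes around the lattice points
are disjoint. Only `E‖L⁻¹ Y‖²` enters this bound.

*Equality of second moments.* The error of the dithered quantizer has mean zero and variance
`Δ² / 12 = 1`, is white, and is orthogonal to everything that does not involve its own dither entry,
since the dither averages any `Δ`-periodic function of the quantizer input
(`integral_periodic_dither_mul`). So the initial state, the plant noise and the quantization noise
of the dithered loop have the same second moments as the initial state, the plant noise and the
sensor noise of the Gaussian loop. These pairs of driving variables span a space of pairs of random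
variables (`loopSpace`) on which mixed second moments agree, and by induction on time every
variable of one loop is paired with its counterpart in the other (`coupled_loops`). The step to be
checked is that of the estimates: a linear estimate is determined by second moments through the
normal equations, and in a Gaussian space the same affine function of the data is the conditional
mean (`IsCoupledSpace.coupled_estimate`). The decoder output is `C₁ (x¹ - xtil)` plus noise, while
the sensor output is `C₁ x¹` plus noise, which makes no difference as the estimate `xtil` is an
affine function of earlier data (`obsSpan_eq_of_shift`).

*Information.* Let `L Lᵀ` be the covariance of `C₁ rtil + v`, the counterpart of `Y` in the Gaussian
loop. It is nonsingular thanks to the noise, whatever `C₁` is. Then `E‖L⁻¹ Y‖² = n`, and the mutual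
information of `C₁ rtil` and `C₁ rtil + v` is at least `log |det L|`, by the variational bound for
the divergence (`log_det_le_klDiv`). Together this gives the claim with `2 π e / 12` in
place of `4 π e / 12`.
-/

namespace DitheredLQG

/-! ### Gaussian densities and the divergence bound -/

open Module InformationTheory in
section
variable {E : Type*} [NormedAddCommGroup E] [InnerProductSpace ℝ E] [FiniteDimensional ℝ E]
  [MeasurableSpace E] [BorelSpace E]

lemma integral_exp_neg_sq_norm_div_two :
    ∫ u : E, Real.exp (-‖u‖ ^ 2 / 2) = (2 * Real.pi) ^ (finrank ℝ E / 2 : ℝ) := by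
  have h := GaussianFourier.integral_rexp_neg_mul_sq_norm (V := E) (b := 1 / 2) (by norm_num)
  rw [show Real.pi / (1 / 2) = 2 * Real.pi by ring] at h
  rw [← h]
  congr with u
  ring_nf

lemma integrable_exp_neg_sq_norm_div_two :
    Integrable (fun u : E => Real.exp (-‖u‖ ^ 2 / 2)) := by
  by_contra h
  have := integral_exp_neg_sq_norm_div_two (E := E)
  rw [integral_undef h] at this
  have h2 : 0 < (2 * Real.pi) ^ (finrank ℝ E / 2 : ℝ) := by positivity
  exact h2.ne this

lemma lintegral_exp_neg_sq_norm_div_two :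
    ∫⁻ u : E, ENNReal.ofReal (Real.exp (-‖u‖ ^ 2 / 2)) =
      ENNReal.ofReal ((2 * Real.pi) ^ (finrank ℝ E / 2 : ℝ)) := by
  rw [← integral_exp_neg_sq_norm_div_two (E := E), ofReal_integral_eq_lintegral_ofReal
    integrable_exp_neg_sq_norm_div_two (ae_of_all _ fun _ => (Real.exp_pos _).le)]

/-- The standard Gaussian measure has density `(2π)^(-d/2) exp(-‖u‖²/2)`; both sides have the same
characteristic function. -/
lemma stdGaussian_eq_withDensity :
    stdGaussian E = (volume : Measure E).withDensity (fun u =>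
      ENNReal.ofReal (((2 * Real.pi) ^ (finrank ℝ E / 2 : ℝ))⁻¹ * Real.exp (-‖u‖ ^ 2 / 2))) := by
  have hpos : 0 < (2 * Real.pi) ^ (finrank ℝ E / 2 : ℝ) := by positivity
  have hm : Measurable (fun u : E =>
      ((2 * Real.pi) ^ (finrank ℝ E / 2 : ℝ))⁻¹ * Real.exp (-‖u‖ ^ 2 / 2)) := by fun_prop
  have : IsFiniteMeasure ((volume : Measure E).withDensity (fun u =>
      ENNReal.ofReal (((2 * Real.pi) ^ (finrank ℝ E / 2 : ℝ))⁻¹ * Real.exp (-‖u‖ ^ 2 / 2)))) := by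
    apply isFiniteMeasure_withDensity
    have := (integrable_exp_neg_sq_norm_div_two (E := E)).const_mul
      (((2 * Real.pi) ^ (finrank ℝ E / 2 : ℝ))⁻¹)
    rw [lintegral_ofReal_ne_top_iff_integrable]
    · exact this
    · exact hm.aestronglyMeasurable
    · exact ae_of_all _ fun u => by positivity
  apply Measure.ext_of_charFun
  ext t
  rw [charFun_stdGaussian, charFun_apply, integral_withDensity_eq_integral_toReal_smul
    (by fun_prop) (ae_of_all _ fun _ => ENNReal.ofReal_lt_top)]
  have h := GaussianFourier.integral_cexp_neg_mul_sq_norm_add (V := E) (b := 1 / 2)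
    (by norm_num) Complex.I t
  have h1 : ∀ u : E, (ENNReal.ofReal (((2 * Real.pi) ^ (finrank ℝ E / 2 : ℝ))⁻¹ *
      Real.exp (-‖u‖ ^ 2 / 2))).toReal • Complex.exp ((inner ℝ u t : ℝ) * Complex.I) =
      (((2 * Real.pi) ^ (finrank ℝ E / 2 : ℝ))⁻¹ : ℝ) *
        Complex.exp (-(1 / 2) * ‖u‖ ^ 2 + Complex.I * (inner ℝ t u : ℝ)) := by
    intro u
    rw [ENNReal.toReal_ofReal (by positivity), Complex.real_smul, Complex.ofReal_mul, mul_assoc,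
      Complex.ofReal_exp, ← Complex.exp_add, real_inner_comm]
    congr 2
    push_cast
    ring
  simp_rw [h1]
  rw [integral_const_mul, h, ← mul_assoc]
  have h2 : (((2 * Real.pi) ^ (finrank ℝ E / 2 : ℝ))⁻¹ : ℝ) *
      ((Real.pi / (1 / 2) : ℂ) ^ (finrank ℝ E / 2 : ℂ)) = 1 := by
    have : ((Real.pi / (1 / 2) : ℂ) ^ (finrank ℝ E / 2 : ℂ)) =
        (((2 * Real.pi) ^ (finrank ℝ E / 2 : ℝ) : ℝ) : ℂ) := by
      rw [Complex.ofReal_cpow (by positivity)]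
      push_cast
      congr 1
      ring
    rw [this, ← Complex.ofReal_mul, inv_mul_cancel₀ hpos.ne', Complex.ofReal_one]
  rw [h2, one_mul, Complex.I_sq]
  congr 1
  ring

lemma lintegral_comp_continuousLinearEquiv (L : E ≃L[ℝ] E) {F : E → ℝ≥0∞} (hF : Measurable F) :
    ∫⁻ x, F (L x) = ENNReal.ofReal |(LinearMap.det (L : E →ₗ[ℝ] E))⁻¹| * ∫⁻ x, F x := by
  have h := Measure.map_linearMap_addHaar_eq_smul_addHaar (volume : Measure E)
    (f := (L : E →ₗ[ℝ] E)) (LinearEquiv.isUnit_det' L.toLinearEquiv).ne_zero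
  have h2 : ∫⁻ x, F (L x) = ∫⁻ x, F x ∂(Measure.map (L : E →ₗ[ℝ] E) volume) := by
    rw [lintegral_map hF (by exact L.continuous.measurable)]
    rfl
  rw [h2, h, lintegral_smul_measure, smul_eq_mul]

/-- A translate of a nondegenerate Gaussian density has total mass one. -/
lemma lintegral_exp_neg_sq_norm_comp_div_two (L : E ≃L[ℝ] E) (a : E) :
    ∫⁻ u : E, ENNReal.ofReal (Real.exp (-‖L u - a‖ ^ 2 / 2)) =
      ENNReal.ofReal (|(LinearMap.det (L : E →ₗ[ℝ] E))⁻¹| *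
        (2 * Real.pi) ^ (finrank ℝ E / 2 : ℝ)) := by
  rw [lintegral_comp_continuousLinearEquiv L
    (F := fun y => ENNReal.ofReal (Real.exp (-‖y - a‖ ^ 2 / 2))) (by fun_prop),
    lintegral_sub_right_eq_self (fun y : E => ENNReal.ofReal (Real.exp (-‖y‖ ^ 2 / 2))) a,
    lintegral_exp_neg_sq_norm_div_two, ENNReal.ofReal_mul (abs_nonneg _)]

/-- Young's inequality for the conjugate pair `klFun` and `exp - 1`. -/
lemma mul_le_klFun_add_exp {r : ℝ} (hr : 0 ≤ r) (a : ℝ) :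
    r * a ≤ klFun r + Real.exp a - 1 := by
  rcases hr.eq_or_lt with rfl | hr
  · simp [klFun, (Real.exp_pos a).le]
  · have h := Real.add_one_le_exp (a - Real.log r)
    rw [Real.exp_sub, Real.exp_log hr, le_div_iff₀ hr] at h
    rw [klFun]
    nlinarith

/-- Variational lower bound for the Kullback-Leibler divergence. -/
lemma ofReal_integral_le_klDiv {α : Type*} [MeasurableSpace α] {μ ν : Measure α}
    [IsProbabilityMeasure μ] [IsProbabilityMeasure ν] {f : α → ℝ} (hf : Measurable f)
    (hfμ : Integrable f μ) (hexp : ∫⁻ x, ENNReal.ofReal (Real.exp (f x)) ∂ν ≤ 1) :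
    ENNReal.ofReal (∫ x, f x ∂μ) ≤ klDiv μ ν := by
  by_cases h : μ ≪ ν ∧ Integrable (llr μ ν) μ
  swap
  · rw [klDiv_eq_integral_klFun, if_neg h]; exact le_top
  obtain ⟨hac, hint⟩ := h
  rw [klDiv_eq_integral_klFun, if_pos ⟨hac, hint⟩]
  apply ENNReal.ofReal_le_ofReal
  have hk : Integrable (fun x => klFun (μ.rnDeriv ν x).toReal) ν :=
    (integrable_klFun_rnDeriv_iff hac).2 hint
  have he : Integrable (fun x => Real.exp (f x)) ν := by
    rw [← lintegral_ofReal_ne_top_iff_integrable (by fun_prop)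
      (ae_of_all _ fun _ => (Real.exp_pos _).le)]
    exact (hexp.trans_lt ENNReal.one_lt_top).ne
  have he1 : ∫ x, Real.exp (f x) ∂ν ≤ 1 := by
    rw [integral_eq_lintegral_of_nonneg_ae (ae_of_all _ fun _ => (Real.exp_pos _).le)
      (by fun_prop)]
    exact ENNReal.toReal_le_of_le_ofReal zero_le_one (by simpa using hexp)
  have hs : Integrable (fun x => (μ.rnDeriv ν x).toReal • f x) ν :=
    (integrable_rnDeriv_smul_iff hac).2 hfμ
  have he' : Integrable (fun x => Real.exp (f x) - 1) ν := he.sub (integrable_const 1)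
  rw [← integral_rnDeriv_smul hac]
  calc ∫ x, (μ.rnDeriv ν x).toReal • f x ∂ν
      ≤ ∫ x, (klFun (μ.rnDeriv ν x).toReal + (Real.exp (f x) - 1)) ∂ν := by
        have hk' : Integrable (fun x => klFun (μ.rnDeriv ν x).toReal + (Real.exp (f x) - 1)) ν :=
          hk.add he'
        apply integral_mono hs hk'
        intro x
        have := mul_le_klFun_add_exp (r := (μ.rnDeriv ν x).toReal) ENNReal.toReal_nonneg (f x)
        simp only [smul_eq_mul]
        linarith
    _ = ∫ x, klFun (μ.rnDeriv ν x).toReal ∂ν + (∫ x, Real.exp (f x) ∂ν - 1) := by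
        rw [integral_add hk he', integral_sub he (integrable_const 1)]
        simp
    _ ≤ _ := by linarith

end

section
variable {ι : Type} [Fintype ι]

lemma memLp_coord_stdGaussian (i : ι) :
    MemLp (fun u : Vec ι => u i) 2 (stdGaussian (Vec ι)) := by
  have h := IsGaussian.memLp_dual (stdGaussian (Vec ι)) (EuclideanSpace.proj (𝕜 := ℝ) i) 2
    (by norm_num)
  exact h

lemma integral_coord_mul_coord_stdGaussian [DecidableEq ι] (i j : ι) :
    ∫ u : Vec ι, u i * u j ∂(stdGaussian (Vec ι)) = if i = j then 1 else 0 := by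
  have h := covariance_eval_multivariateGaussian (μ := (0 : Vec ι)) (S := (1 : Matrix ι ι ℝ))
    Matrix.PosSemidef.one i j
  have hz : ∀ k : ι, ∫ u : Vec ι, u k ∂(stdGaussian (Vec ι)) = 0 := fun k =>
    integral_strongDual_stdGaussian (E := Vec ι) (EuclideanSpace.proj (𝕜 := ℝ) k)
  rw [multivariateGaussian_zero_one, covariance_eq_sub (memLp_coord_stdGaussian i)
    (memLp_coord_stdGaussian j)] at h
  simp only [hz, mul_zero, sub_zero, Pi.mul_apply] at h
  rw [h, Matrix.one_apply]

lemma integrable_sq_norm_stdGaussian :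
    Integrable (fun u : Vec ι => ‖u‖ ^ 2) (stdGaussian (Vec ι)) :=
  (IsGaussian.memLp_two_id (μ := stdGaussian (Vec ι))).integrable_norm_pow (by norm_num)

lemma integral_sq_norm_stdGaussian :
    ∫ u : Vec ι, ‖u‖ ^ 2 ∂(stdGaussian (Vec ι)) = Fintype.card ι := by
  classical
  simp_rw [EuclideanSpace.real_norm_sq_eq]
  rw [integral_finsetSum _ fun i _ => (memLp_coord_stdGaussian i).integrable_sq]
  simp [pow_two, integral_coord_mul_coord_stdGaussian]

/-- If `Y = L U` in law with `U` standard Gaussian, then `L⁻¹ Y` is standard Gaussian, and so its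
mean squared norm is the dimension. -/
lemma integral_sq_norm_whitened {Ω : Type*} [MeasurableSpace Ω] {P : Measure Ω}
    {Y : Ω → Vec ι} (hY : Measurable Y) (L : Vec ι ≃L[ℝ] Vec ι)
    (hlaw : P.map Y = (stdGaussian (Vec ι)).map L) :
    Integrable (fun ω => ‖L.symm (Y ω)‖ ^ 2) P ∧
      ∫ ω, ‖L.symm (Y ω)‖ ^ 2 ∂P = Fintype.card ι := by
  have hLm : Measurable fun y : Vec ι => L.symm y := L.symm.continuous.measurable
  have hwhite : P.map (fun ω => L.symm (Y ω)) = stdGaussian (Vec ι) := by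
    rw [show (fun ω => L.symm (Y ω)) = (fun y => L.symm y) ∘ Y from rfl,
      ← Measure.map_map hLm hY, hlaw, Measure.map_map hLm L.continuous.measurable]
    simp [Function.comp_def]
  constructor
  · have h := integrable_sq_norm_stdGaussian (ι := ι)
    rw [← hwhite] at h
    exact h.comp_measurable (hLm.comp hY)
  · rw [← integral_sq_norm_stdGaussian (ι := ι), ← hwhite,
      integral_map (φ := fun ω => L.symm (Y ω)) (hLm.comp hY).aemeasurable (by fun_prop)]

/-- If `Y = L U` in law with `U` standard Gaussian, and `Y - X` has the second moment of a standard
Gaussian vector, then the mutual information of `X` and `Y` is at least `log |det L|`. The test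
function in the variational bound is the logarithm of the density ratio of the channel with
standard Gaussian noise. -/
lemma log_det_le_klDiv {Ω : Type*} [MeasurableSpace Ω] {P : Measure Ω} [IsProbabilityMeasure P]
    {X Y : Ω → Vec ι} (hX : Measurable X) (hY : Measurable Y) (L : Vec ι ≃L[ℝ] Vec ι)
    (hlaw : P.map Y = (stdGaussian (Vec ι)).map L)
    (hint : Integrable (fun ω => ‖Y ω - X ω‖ ^ 2) P)
    (hnoise : ∫ ω, ‖Y ω - X ω‖ ^ 2 ∂P = Fintype.card ι) :
    ENNReal.ofReal (Real.log |LinearMap.det (L : Vec ι →ₗ[ℝ] Vec ι)|) ≤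
      InformationTheory.klDiv (P.map (fun ω => (X ω, Y ω))) ((P.map X).prod (P.map Y)) := by
  set D : ℝ := |LinearMap.det (L : Vec ι →ₗ[ℝ] Vec ι)| with hD
  have hDpos : 0 < D := abs_pos.2 (LinearEquiv.isUnit_det' L.toLinearEquiv).ne_zero
  let f : Vec ι × Vec ι → ℝ := fun z =>
    -‖z.2 - z.1‖ ^ 2 / 2 + ‖L.symm z.2‖ ^ 2 / 2 + Real.log D
  have hf : Measurable f := by
    have : Measurable fun z : Vec ι × Vec ι => L.symm z.2 :=
      L.symm.continuous.measurable.comp measurable_snd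
    fun_prop
  have hXY : Measurable (fun ω => (X ω, Y ω)) := hX.prodMk hY
  have := Measure.isProbabilityMeasure_map (μ := P) hX.aemeasurable
  have := Measure.isProbabilityMeasure_map (μ := P) hY.aemeasurable
  have := Measure.isProbabilityMeasure_map (μ := P) hXY.aemeasurable
  have hLm : Measurable fun y : Vec ι => L.symm y := L.symm.continuous.measurable
  obtain ⟨hYi, hYe⟩ := integral_sq_norm_whitened hY L hlaw
  have hfi : Integrable (fun ω => f (X ω, Y ω)) P :=
    ((hint.neg.div_const 2).add (hYi.div_const 2)).add (integrable_const _)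
  have hfe : ∫ z, f z ∂(P.map (fun ω => (X ω, Y ω))) = Real.log D := by
    rw [integral_map hXY.aemeasurable hf.aestronglyMeasurable]
    have h1 : Integrable (fun ω => -‖Y ω - X ω‖ ^ 2 / 2) P := hint.neg.div_const 2
    have h2 : Integrable (fun ω => ‖L.symm (Y ω)‖ ^ 2 / 2) P := hYi.div_const 2
    have h12 : Integrable (fun ω => -‖Y ω - X ω‖ ^ 2 / 2 + ‖L.symm (Y ω)‖ ^ 2 / 2) P := h1.add h2
    simp only [f]
    rw [integral_add h12 (integrable_const _), integral_add h1 h2, integral_div,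
      integral_div, integral_neg, hnoise, hYe]
    simp
    ring
  rw [← hfe]
  refine ofReal_integral_le_klDiv hf
    ((integrable_map_measure hf.aestronglyMeasurable hXY.aemeasurable).2 hfi) ?_
  rw [lintegral_prod _ (by fun_prop)]
  have hone : ∀ x : Vec ι, ∫⁻ y, ENNReal.ofReal (Real.exp (f (x, y))) ∂(P.map Y) = 1 := by
    intro x
    have hm : Measurable fun y : Vec ι => ENNReal.ofReal (Real.exp (f (x, y))) := by fun_prop
    have hmL : Measurable fun u : Vec ι => ENNReal.ofReal (Real.exp (f (x, L u))) :=
      hm.comp L.continuous.measurable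
    rw [hlaw, lintegral_map hm L.continuous.measurable, stdGaussian_eq_withDensity,
      lintegral_withDensity_eq_lintegral_mul _ (by fun_prop) hmL]
    have hpt : ∀ u : Vec ι,
        ((fun u : Vec ι => ENNReal.ofReal (((2 * Real.pi) ^ (Module.finrank ℝ (Vec ι) / 2 : ℝ))⁻¹ *
          Real.exp (-‖u‖ ^ 2 / 2))) * fun u => ENNReal.ofReal (Real.exp (f (x, L u)))) u =
        ENNReal.ofReal (((2 * Real.pi) ^ (Module.finrank ℝ (Vec ι) / 2 : ℝ))⁻¹ * D) *
          ENNReal.ofReal (Real.exp (-‖L u - x‖ ^ 2 / 2)) := by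
      intro u
      simp only [Pi.mul_apply]
      rw [← ENNReal.ofReal_mul (by positivity), ← ENNReal.ofReal_mul (by positivity)]
      congr 1
      simp only [f, ContinuousLinearEquiv.symm_apply_apply]
      rw [Real.exp_add, Real.exp_add, Real.exp_log hDpos]
      have : Real.exp (-‖u‖ ^ 2 / 2) * Real.exp (‖u‖ ^ 2 / 2) = 1 := by
        rw [← Real.exp_add]; simp [neg_div]
      linear_combination (((2 * Real.pi) ^ (Module.finrank ℝ (Vec ι) / 2 : ℝ))⁻¹ *
        Real.exp (-‖L u - x‖ ^ 2 / 2) * D) * this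
    rw [lintegral_congr hpt, lintegral_const_mul _ (by fun_prop),
      lintegral_exp_neg_sq_norm_comp_div_two, ← ENNReal.ofReal_mul (by positivity), abs_inv, ← hD]
    rw [show ((2 * Real.pi) ^ (Module.finrank ℝ (Vec ι) / 2 : ℝ))⁻¹ * D *
      (D⁻¹ * (2 * Real.pi) ^ (Module.finrank ℝ (Vec ι) / 2 : ℝ)) = 1 by
        have : 0 < (2 * Real.pi) ^ (Module.finrank ℝ (Vec ι) / 2 : ℝ) := by positivity
        field_simp]
    simp
  simp [hone]

end

/-! ### Entropy of a dithered lattice quantizer -/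

section
variable {ι : Type} [Fintype ι]

/-- The cube of side `Δ` centred at the origin, the range of the dither. -/
def ditherCube (ι : Type) (Δ : ℝ) : Set (Vec ι) := {δ | ∀ i, δ i ∈ Set.Ico (-(Δ / 2)) (Δ / 2)}

/-- The lattice `(Δℤ)^ι` of quantizer outputs. -/
def quantLattice (ι : Type) (Δ : ℝ) : Set (Vec ι) := {z | ∃ k : ι → ℤ, ∀ i, z i = k i * Δ}

lemma countable_quantLattice (Δ : ℝ) : (quantLattice ι Δ).Countable := by
  have : quantLattice ι Δ =
      Set.range (fun k : ι → ℤ => (WithLp.toLp 2 (fun i => (k i : ℝ) * Δ) : Vec ι)) := by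
    ext z
    constructor
    · rintro ⟨k, hk⟩
      exact ⟨k, by ext i; simp [hk]⟩
    · rintro ⟨k, rfl⟩
      exact ⟨k, fun i => rfl⟩
  rw [this]
  exact Set.countable_range _

lemma quantize_mem_quantLattice {ι : Type} (Δ : ℝ) (z : Vec ι) : quantize Δ z ∈ quantLattice ι Δ :=
  ⟨fun i => ⌊z i / Δ + 1 / 2⌋, fun _ => rfl⟩

lemma measurableSet_ditherCube (Δ : ℝ) : MeasurableSet (ditherCube ι Δ) := by
  have : ditherCube ι Δ = ⋂ i, (fun δ : Vec ι => δ i) ⁻¹' Set.Ico (-(Δ / 2)) (Δ / 2) := by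
    ext; simp [ditherCube]
  rw [this]
  exact MeasurableSet.iInter fun i => measurableSet_Ico.preimage (by fun_prop)

/-- The reflected cubes around the lattice points are disjoint, so integrating a function along all
lattice translates of the dither does not exceed its full integral. -/
lemma lintegral_ditherCube_tsum_le {Δ : ℝ} (hΔ : 0 < Δ) {g : Vec ι → ℝ≥0∞} (hg : Measurable g) :
    ∫⁻ δ in ditherCube ι Δ, ∑' z : quantLattice ι Δ, g (z - δ) ≤ ∫⁻ y, g y := by
  have : Countable (quantLattice ι Δ) := (countable_quantLattice Δ).to_subtype
  let T : quantLattice ι Δ → Set (Vec ι) := fun z => (fun y => (z : Vec ι) - y) ⁻¹' ditherCube ι Δ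
  have hT : ∀ z, MeasurableSet (T z) := fun z =>
    (measurableSet_ditherCube Δ).preimage (by fun_prop)
  have hdisj : Pairwise (Function.onFun Disjoint T) := by
    rintro ⟨z, k, hk⟩ ⟨z', k', hk'⟩ hne
    refine Set.disjoint_left.2 fun y hy hy' => hne ?_
    ext i
    have h1 := hy i
    have h2 := hy' i
    simp only [PiLp.sub_apply, Set.mem_Ico, hk, hk'] at h1 h2
    have h3 : ((k i - k' i : ℤ) : ℝ) * Δ < 1 * Δ := by push_cast; linarith
    have h4 : ((k' i - k i : ℤ) : ℝ) * Δ < 1 * Δ := by push_cast; linarith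
    have h5 := lt_of_mul_lt_mul_right h3 hΔ.le
    have h6 := lt_of_mul_lt_mul_right h4 hΔ.le
    norm_cast at h5 h6
    have : k i = k' i := by omega
    simp [hk, hk', this]
  calc ∫⁻ δ in ditherCube ι Δ, ∑' z : quantLattice ι Δ, g (z - δ)
      = ∑' z : quantLattice ι Δ, ∫⁻ δ in ditherCube ι Δ, g (z - δ) :=
        lintegral_tsum fun z => by fun_prop
    _ = ∑' z : quantLattice ι Δ, ∫⁻ y in T z, g y := by
        congr with z
        rw [← lintegral_indicator (measurableSet_ditherCube Δ), ← lintegral_indicator (hT z),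
          ← lintegral_sub_left_eq_self (fun δ => (T z).indicator g δ) (z : Vec ι)]
        congr with y
        have h : (z : Vec ι) - y ∈ T z ↔ y ∈ ditherCube ι Δ := by
          change (z : Vec ι) - (z - y) ∈ ditherCube ι Δ ↔ _
          rw [sub_sub_cancel]
        by_cases hy : y ∈ ditherCube ι Δ
        · rw [Set.indicator_of_mem hy, Set.indicator_of_mem (h.2 hy)]
        · rw [Set.indicator_of_notMem hy, Set.indicator_of_notMem (fun h2 => hy (h.1 h2))]
    _ = ∫⁻ y in ⋃ z, T z, g y := (lintegral_iUnion hT hdisj g).symm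
    _ ≤ ∫⁻ y, g y := setLIntegral_le_lintegral _ _

/-- Gibbs' inequality for a law carried by a countable set `S`: `F` plays the role of
`-log q` for a candidate weight `q`. The shift by `c` keeps all terms nonnegative. -/
lemma entropyBits_add_le {α : Type*} [MeasurableSpace α] [MeasurableSingletonClass α]
    {κ : Measure α} [IsProbabilityMeasure κ] {S : Set α} (hS : S.Countable) (hκ : κ Sᶜ = 0)
    {F : α → ℝ} {c : ℝ} (hc : 0 ≤ c) (hF : ∀ x, 0 ≤ F x + c) :
    ENNReal.ofReal (Real.log 2) * entropyBits κ + ENNReal.ofReal (1 + c) ≤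
      ∫⁻ x, ENNReal.ofReal (F x + c) ∂κ + ∑' x : S, ENNReal.ofReal (Real.exp (-F x)) := by
  have hlog : 0 < Real.log 2 := Real.log_pos one_lt_two
  have hent : ENNReal.ofReal (Real.log 2) * entropyBits κ =
      ∑' x : S, ENNReal.ofReal (Real.negMulLog (κ.real {(x : α)})) := by
    rw [entropyBits, if_pos ⟨S, hS, hκ⟩, ← ENNReal.tsum_mul_left]
    have hterm : ∀ x, ENNReal.ofReal (Real.log 2) *
        ENNReal.ofReal (Real.negMulLog (κ.real {x}) / Real.log 2) =
        ENNReal.ofReal (Real.negMulLog (κ.real {x})) := by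
      intro x
      rw [← ENNReal.ofReal_mul hlog.le, mul_div_cancel₀ _ hlog.ne']
    simp_rw [hterm]
    refine (tsum_subtype_eq_of_support_subset
      (f := fun x => ENNReal.ofReal (Real.negMulLog (κ.real {x}))) fun x hx => ?_).symm
    by_contra hxS
    apply hx
    have : κ {x} = 0 := measure_mono_null (by simpa using hxS) hκ
    simp [measureReal_def, this]
  have hone : κ S = 1 := (prob_compl_eq_zero_iff hS.measurableSet).1 hκ
  have hmass : ENNReal.ofReal (1 + c) =
      ∑' x : S, ENNReal.ofReal ((1 + c) * κ.real {(x : α)}) := by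
    have h1 : ∑' x : S, κ {(x : α)} = 1 := by
      rw [← hone, ← setLIntegral_one, lintegral_countable _ hS]
      simp
    rw [← mul_one (ENNReal.ofReal (1 + c)), ← h1, ← ENNReal.tsum_mul_left]
    congr with x
    rw [ENNReal.ofReal_mul (by linarith), ofReal_measureReal]
  have hint : ∫⁻ x, ENNReal.ofReal (F x + c) ∂κ =
      ∑' x : S, ENNReal.ofReal ((F x + c) * κ.real {(x : α)}) := by
    rw [← Measure.restrict_eq_self_of_ae_mem (s := S) (μ := κ) (by rwa [ae_iff]),
      lintegral_countable _ hS]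
    congr with x
    rw [ENNReal.ofReal_mul (hF x), ofReal_measureReal,
      Measure.restrict_eq_self_of_ae_mem (s := S) (μ := κ) (by rwa [ae_iff])]
  rw [hent, hmass, hint, ← ENNReal.tsum_add, ← ENNReal.tsum_add]
  refine ENNReal.tsum_le_tsum fun x => ?_
  have hp0 : 0 ≤ κ.real {(x : α)} := measureReal_nonneg
  have hp1 : κ.real {(x : α)} ≤ 1 := measureReal_le_one
  rw [← ENNReal.ofReal_add (Real.negMulLog_nonneg hp0 hp1) (by positivity),
    ← ENNReal.ofReal_add (mul_nonneg (hF x) hp0) (Real.exp_pos _).le]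
  apply ENNReal.ofReal_le_ofReal
  rw [Real.negMulLog]
  have hy := mul_le_klFun_add_exp hp0 (-F x)
  rw [InformationTheory.klFun] at hy
  linarith

lemma map_eq_smul_volume_restrict_ditherCube {Ω : Type*} [MeasurableSpace Ω] {P : Measure Ω}
    [IsProbabilityMeasure P] {d : Ω → Vec ι} (hd : Measurable d) {Δ : ℝ} (hΔ : 0 < Δ)
    (hunif : ∀ i, pdf.IsUniform (fun ω => d ω i) (Set.Ico (-(Δ / 2)) (Δ / 2)) P volume)
    (hind : iIndepFun (fun i ω => d ω i) P) :
    P.map d = (ENNReal.ofReal (Δ ^ Fintype.card ι))⁻¹ • volume.restrict (ditherCube ι Δ) := by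
  have hdi : ∀ i, Measurable fun ω => d ω i := fun i => by fun_prop
  have hpi : P.map (fun ω i => d ω i) = (ENNReal.ofReal (Δ ^ Fintype.card ι))⁻¹ •
      (volume : Measure (ι → ℝ)).restrict
        (Set.univ.pi fun _ => Set.Ico (-(Δ / 2)) (Δ / 2)) := by
    rw [(iIndepFun_iff_map_fun_eq_pi_map fun i => (hdi i).aemeasurable).1 hind]
    refine Measure.pi_eq fun s hs => ?_
    rw [Measure.smul_apply, Measure.restrict_apply (MeasurableSet.univ_pi hs),
      ← Set.pi_inter_distrib, volume_pi_pi]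
    have : ∀ i, P.map (fun ω => d ω i) (s i) =
        (ENNReal.ofReal Δ)⁻¹ * volume (s i ∩ Set.Ico (-(Δ / 2)) (Δ / 2)) := by
      intro i
      rw [hunif i, cond_apply measurableSet_Ico, Real.volume_Ico, Set.inter_comm]
      congr 3
      ring
    simp_rw [this]
    rw [Finset.prod_mul_distrib, Finset.prod_const, Finset.card_univ, ENNReal.ofReal_pow hΔ.le,
      ENNReal.inv_pow, smul_eq_mul]
  have hto : P.map d = (P.map (fun ω i => d ω i)).map (WithLp.toLp 2) := by
    rw [Measure.map_map (by fun_prop) (by fun_prop)]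
    rfl
  have hpre : (Set.univ.pi fun _ : ι => Set.Ico (-(Δ / 2)) (Δ / 2)) =
      (WithLp.toLp 2 : (ι → ℝ) → Vec ι) ⁻¹' ditherCube ι Δ := by
    ext x; simp [ditherCube]
  rw [hto, hpi, Measure.map_smul, hpre, (PiLp.volume_preserving_toLp ι).restrict_preimage
    (measurableSet_ditherCube Δ) |>.map_eq]

/-- The conditional entropy of a lattice-valued `Z` given a uniform dither `D` is at most the
differential cross entropy of `Z - D` relative to a Gaussian density `N(0, L Lᵀ)`, less
`card ι * log Δ`. -/
lemma condEntropyBits_le {Ω : Type*} [MeasurableSpace Ω] {P : Measure Ω} [IsProbabilityMeasure P]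
    {Z D : Ω → Vec ι} (hZ : Measurable Z) (hD : Measurable D) {Δ : ℝ} (hΔ : 0 < Δ)
    (hZmem : ∀ ω, Z ω ∈ quantLattice ι Δ)
    (hDlaw : P.map D = (ENNReal.ofReal (Δ ^ Fintype.card ι))⁻¹ • volume.restrict (ditherCube ι Δ))
    (L : Vec ι ≃L[ℝ] Vec ι) (hint : Integrable (fun ω => ‖L.symm (Z ω - D ω)‖ ^ 2) P)
    (hsec : ∫ ω, ‖L.symm (Z ω - D ω)‖ ^ 2 ∂P = Fintype.card ι) :
    ENNReal.ofReal (Real.log 2) * condEntropyBits Z D P ≤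
      ENNReal.ofReal (-Real.log (Δ ^ Fintype.card ι * ((2 * Real.pi) ^ (Fintype.card ι / 2 : ℝ))⁻¹ *
        |LinearMap.det (L : Vec ι →ₗ[ℝ] Vec ι)|⁻¹) + Fintype.card ι / 2) := by
  set T : ℝ := |LinearMap.det (L : Vec ι →ₗ[ℝ] Vec ι)| with hT
  have hTpos : 0 < T := abs_pos.2 (LinearEquiv.isUnit_det' L.toLinearEquiv).ne_zero
  set A : ℝ := Δ ^ Fintype.card ι * ((2 * Real.pi) ^ (Fintype.card ι / 2 : ℝ))⁻¹ * T⁻¹ with hA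
  have hApos : 0 < A := by positivity
  set c : ℝ := |Real.log A| with hc
  have hc0 : 0 ≤ c := abs_nonneg _
  have hLm : Measurable fun y : Vec ι => L.symm y := L.symm.continuous.measurable
  let G : Vec ι → ℝ := fun y => -Real.log A + ‖L.symm y‖ ^ 2 / 2
  have hGm : Measurable G := by fun_prop
  have hGc : ∀ y, 0 ≤ G y + c := fun y => by
    have : -Real.log A + c ≥ 0 := by linarith [le_abs_self (Real.log A)]
    have h2 : 0 ≤ ‖L.symm y‖ ^ 2 / 2 := by positivity
    simp only [G]; linarith
  have hcomp : (P.map D) ⊗ₘ condDistrib Z D P = P.map (fun ω => (D ω, Z ω)) :=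
    compProd_map_condDistrib hZ.aemeasurable
  have := Measure.isProbabilityMeasure_map (μ := P) hD.aemeasurable
  have hcarried : ∀ᵐ δ ∂(P.map D), condDistrib Z D P δ (quantLattice ι Δ)ᶜ = 0 := by
    have hms : MeasurableSet {p : Vec ι × Vec ι | p.2 ∈ quantLattice ι Δ} :=
      (countable_quantLattice Δ).measurableSet.preimage measurable_snd
    have h : ∀ᵐ p ∂((P.map D) ⊗ₘ condDistrib Z D P), p.2 ∈ quantLattice ι Δ := by
      rw [hcomp, ae_map_iff (by fun_prop) hms]
      exact ae_of_all _ hZmem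
    filter_upwards [Measure.ae_ae_of_ae_compProd h] with δ hδ
    rwa [ae_iff] at hδ
  have hkey : ENNReal.ofReal (Real.log 2) * condEntropyBits Z D P + ENNReal.ofReal (1 + c) ≤
      ∫⁻ δ, ∫⁻ z, ENNReal.ofReal (G (z - δ) + c) ∂(condDistrib Z D P δ) ∂(P.map D) +
      ∫⁻ δ, ∑' z : quantLattice ι Δ, ENNReal.ofReal (Real.exp (-G (z - δ))) ∂(P.map D) := by
    have : Countable (quantLattice ι Δ) := (countable_quantLattice Δ).to_subtype
    have hmsum : Measurable fun δ : Vec ι =>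
        ∑' z : quantLattice ι Δ, ENNReal.ofReal (Real.exp (-G (z - δ))) :=
      Measurable.tsum fun z => by fun_prop
    rw [condEntropyBits, ← lintegral_const_mul' _ _ ENNReal.ofReal_ne_top,
      ← lintegral_add_right _ hmsum]
    have hconst : ENNReal.ofReal (1 + c) = ∫⁻ _, ENNReal.ofReal (1 + c) ∂(P.map D) := by simp
    rw [hconst, ← lintegral_add_right _ measurable_const]
    refine lintegral_mono_ae ?_
    filter_upwards [hcarried] with δ hδ
    exact entropyBits_add_le (countable_quantLattice Δ) hδ (F := fun z => G (z - δ)) hc0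
      fun z => hGc _
  have hfirst : ∫⁻ δ, ∫⁻ z, ENNReal.ofReal (G (z - δ) + c) ∂(condDistrib Z D P δ) ∂(P.map D) =
      ENNReal.ofReal (-Real.log A + Fintype.card ι / 2 + c) := by
    have hGi : Integrable (fun ω => G (Z ω - D ω) + c) P :=
      ((integrable_const _).add (hint.div_const 2)).add (integrable_const _)
    have hm : Measurable fun p : Vec ι × Vec ι => ENNReal.ofReal (G (p.2 - p.1) + c) := by fun_prop
    rw [← Measure.lintegral_compProd (f := fun p => ENNReal.ofReal (G (p.2 - p.1) + c)) hm, hcomp,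
      lintegral_map hm (by fun_prop), ← ofReal_integral_eq_lintegral_ofReal hGi
        (ae_of_all _ fun ω => hGc _)]
    congr 1
    have h2 : Integrable (fun ω => ‖L.symm (Z ω - D ω)‖ ^ 2 / 2) P := hint.div_const 2
    have h3 : Integrable (fun ω => -Real.log A + ‖L.symm (Z ω - D ω)‖ ^ 2 / 2) P :=
      (integrable_const _).add h2
    simp only [G]
    rw [integral_add h3 (integrable_const _), integral_add (integrable_const _) h2, integral_div,
      hsec]
    simp
  have hsecond : ∫⁻ δ, ∑' z : quantLattice ι Δ, ENNReal.ofReal (Real.exp (-G (z - δ))) ∂(P.map D)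
      ≤ 1 := by
    rw [hDlaw, lintegral_smul_measure, smul_eq_mul]
    have hmg : Measurable fun y => ENNReal.ofReal (Real.exp (-G y)) := by fun_prop
    calc _ ≤ (ENNReal.ofReal (Δ ^ Fintype.card ι))⁻¹ * ∫⁻ y, ENNReal.ofReal (Real.exp (-G y)) := by
          exact mul_le_mul_right (lintegral_ditherCube_tsum_le hΔ hmg) _
      _ = 1 := by
          have hpt : ∀ y, ENNReal.ofReal (Real.exp (-G y)) =
              ENNReal.ofReal A * ENNReal.ofReal (Real.exp (-‖L.symm y - 0‖ ^ 2 / 2)) := by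
            intro y
            rw [← ENNReal.ofReal_mul hApos.le]
            simp only [G, sub_zero]
            rw [show -(-Real.log A + ‖L.symm y‖ ^ 2 / 2) = Real.log A + -‖L.symm y‖ ^ 2 / 2 by ring,
              Real.exp_add, Real.exp_log hApos]
          rw [lintegral_congr hpt, lintegral_const_mul _ (by fun_prop),
            lintegral_exp_neg_sq_norm_comp_div_two L.symm 0]
          have hdet : |(LinearMap.det (L.symm : Vec ι →ₗ[ℝ] Vec ι))⁻¹| = T := by
            rw [hT]
            congr 1
            rw [inv_eq_iff_eq_inv]
            exact LinearEquiv.det_coe_symm L.toLinearEquiv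
          rw [hdet, finrank_euclideanSpace, ← ENNReal.ofReal_mul hApos.le,
            ← ENNReal.ofReal_inv_of_pos (by positivity), ← ENNReal.ofReal_mul (by positivity), hA]
          have h2pi : 0 < (2 * Real.pi) ^ (Fintype.card ι / 2 : ℝ) := by positivity
          rw [← ENNReal.ofReal_one]
          congr 1
          field_simp
  rw [hfirst] at hkey
  have hfin := hkey.trans (add_le_add_right hsecond _)
  rw [ENNReal.ofReal_add zero_le_one hc0, ENNReal.ofReal_one, add_comm 1, ← add_assoc] at hfin
  have hfin2 := (ENNReal.add_le_add_iff_right ENNReal.one_ne_top).1 hfin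
  have hfin3 := ENNReal.le_sub_of_add_le_right ENNReal.ofReal_ne_top hfin2
  rwa [← ENNReal.ofReal_sub _ hc0, add_sub_cancel_right] at hfin3

end

/-! ### Subtractive dither -/

/-- The error of the scalar quantizer of step `Δ` at the input `z`. -/
noncomputable def quantError (Δ z : ℝ) : ℝ := (⌊z / Δ + 1 / 2⌋ : ℝ) * Δ - z

lemma measurable_quantError (Δ : ℝ) : Measurable (quantError Δ) := by
  unfold quantError
  have : Measurable fun z : ℝ => ((⌊z / Δ + 1 / 2⌋ : ℤ) : ℝ) :=
    (measurable_from_top (f := fun k : ℤ => (k : ℝ))).comp (Int.measurable_floor.comp (by fun_prop))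
  fun_prop

lemma periodic_quantError {Δ : ℝ} (hΔ : 0 < Δ) : Function.Periodic (quantError Δ) Δ := by
  intro z
  have : (z + Δ) / Δ + 1 / 2 = z / Δ + 1 / 2 + (1 : ℤ) := by
    push_cast
    field_simp
    ring
  rw [quantError, this, Int.floor_add_intCast, quantError]
  push_cast
  ring

lemma abs_quantError_le {Δ : ℝ} (hΔ : 0 < Δ) (z : ℝ) : |quantError Δ z| ≤ Δ / 2 := by
  have h1 := Int.floor_le (z / Δ + 1 / 2)
  have h2 := Int.lt_floor_add_one (z / Δ + 1 / 2)
  have h3 : z = z / Δ * Δ := by field_simp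
  have h4 := mul_le_mul_of_nonneg_right h1 hΔ.le
  have h5 := mul_lt_mul_of_pos_right h2 hΔ
  rw [quantError, abs_le]
  constructor <;> nlinarith

lemma quantError_of_mem {Δ z : ℝ} (hΔ : 0 < Δ) (hz : z ∈ Set.Ioo (-(Δ / 2)) (Δ / 2)) :
    quantError Δ z = -z := by
  have h3 : z = z / Δ * Δ := by field_simp
  have : ⌊z / Δ + 1 / 2⌋ = 0 := by
    rw [Int.floor_eq_zero_iff]
    have h1 : -(1 / 2) * Δ < z / Δ * Δ := by rw [← h3]; linarith [hz.1]
    have h2 : z / Δ * Δ < (1 / 2) * Δ := by rw [← h3]; linarith [hz.2]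
    have := lt_of_mul_lt_mul_right h1 hΔ.le
    have := lt_of_mul_lt_mul_right h2 hΔ.le
    constructor <;> linarith
  rw [quantError, this]
  simp

lemma intervalIntegral_comp_quantError {Δ : ℝ} (hΔ : 0 < Δ) (f : ℝ → ℝ) :
    ∫ z in (-(Δ / 2))..(Δ / 2), f (quantError Δ z) = ∫ z in (-(Δ / 2))..(Δ / 2), f (-z) := by
  have hle : -(Δ / 2) ≤ Δ / 2 := by linarith
  rw [intervalIntegral.integral_of_le hle, intervalIntegral.integral_of_le hle,
    integral_Ioc_eq_integral_Ioo, integral_Ioc_eq_integral_Ioo]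
  exact setIntegral_congr_fun measurableSet_Ioo fun z hz => by
    simp only [quantError_of_mem hΔ hz]

section
variable {Ω : Type*} [MeasurableSpace Ω] {P : Measure Ω} [IsProbabilityMeasure P]

/-- Averaging property of a subtractive dither: the mean of a periodic function of `a + D` does not
see `a`, even jointly with any further variable `F` that is independent of the dither. -/
lemma integral_periodic_dither_mul {a F D : Ω → ℝ} {Δ : ℝ} (hΔ : 0 < Δ) (ha : Measurable a)
    (hF : Measurable F) (hD : Measurable D)
    (hunif : pdf.IsUniform D (Set.Ico (-(Δ / 2)) (Δ / 2)) P volume)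
    (hind : IndepFun D (fun ω => (a ω, F ω)) P) (hFi : Integrable F P)
    {h : ℝ → ℝ} (hh : Measurable h) (hper : Function.Periodic h Δ) {C : ℝ}
    (hb : ∀ z, |h z| ≤ C) :
    ∫ ω, h (a ω + D ω) * F ω ∂P =
      (Δ⁻¹ * ∫ z in (-(Δ / 2))..(Δ / 2), h z) * ∫ ω, F ω ∂P := by
  have haF : Measurable fun ω => (a ω, F ω) := ha.prodMk hF
  have hmap : P.map (fun ω => ((a ω, F ω), D ω)) = (P.map fun ω => (a ω, F ω)).prod (P.map D) :=
    (indepFun_iff_map_prod_eq_prod_map_map haF.aemeasurable hD.aemeasurable).1 hind.symm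
  have := Measure.isProbabilityMeasure_map (μ := P) haF.aemeasurable
  have := Measure.isProbabilityMeasure_map (μ := P) hD.aemeasurable
  have hg : Measurable fun z : (ℝ × ℝ) × ℝ => h (z.1.1 + z.2) * z.1.2 := by fun_prop
  have hint : Integrable (fun ω => h (a ω + D ω) * F ω) P :=
    hFi.bdd_mul (c := C) (hh.comp (ha.add hD)).aestronglyMeasurable (ae_of_all _ fun ω => hb _)
  have hinner : ∀ b : ℝ, ∫ δ, h (b + δ) ∂(P.map D) =
      Δ⁻¹ * ∫ z in (-(Δ / 2))..(Δ / 2), h z := by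
    intro b
    have hle : -(Δ / 2) ≤ Δ / 2 := by linarith
    rw [hunif, ProbabilityTheory.cond, integral_smul_measure, Real.volume_Ico,
      show Δ / 2 - -(Δ / 2) = Δ by ring, ENNReal.toReal_inv, ENNReal.toReal_ofReal hΔ.le,
      smul_eq_mul, integral_Ico_eq_integral_Ioc, ← intervalIntegral.integral_of_le hle,
      intervalIntegral.integral_comp_add_left (fun z => h z) b]
    have := hper.intervalIntegral_add_eq (b + -(Δ / 2)) (-(Δ / 2))
    rw [show b + -(Δ / 2) + Δ = b + Δ / 2 by ring, show -(Δ / 2) + Δ = Δ / 2 by ring] at this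
    rw [this]
  calc ∫ ω, h (a ω + D ω) * F ω ∂P
      = ∫ z, h (z.1.1 + z.2) * z.1.2 ∂(P.map fun ω => ((a ω, F ω), D ω)) := by
        rw [integral_map (by fun_prop) hg.aestronglyMeasurable]
    _ = ∫ p, ∫ δ, h (p.1 + δ) * p.2 ∂(P.map D) ∂(P.map fun ω => (a ω, F ω)) := by
        rw [hmap, integral_prod]
        rw [← hmap]
        exact (integrable_map_measure hg.aestronglyMeasurable (by fun_prop)).2 hint
    _ = ∫ p, (Δ⁻¹ * ∫ z in (-(Δ / 2))..(Δ / 2), h z) * p.2 ∂(P.map fun ω => (a ω, F ω)) := by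
        congr with p
        rw [integral_mul_const, hinner]
    _ = _ := by
        rw [integral_const_mul, integral_map haF.aemeasurable (by fun_prop)]

/-- The error of a dithered quantizer is orthogonal to every variable `F` that, jointly with the
input `a`, is independent of the dither. -/
lemma integral_quantError_mul {a F D : Ω → ℝ} {Δ : ℝ} (hΔ : 0 < Δ) (ha : Measurable a)
    (hF : Measurable F) (hD : Measurable D)
    (hunif : pdf.IsUniform D (Set.Ico (-(Δ / 2)) (Δ / 2)) P volume)
    (hind : IndepFun D (fun ω => (a ω, F ω)) P) (hFi : Integrable F P) :
    ∫ ω, quantError Δ (a ω + D ω) * F ω ∂P = 0 := by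
  rw [integral_periodic_dither_mul hΔ ha hF hD hunif hind hFi (measurable_quantError Δ)
    (periodic_quantError hΔ) (abs_quantError_le hΔ),
    intervalIntegral_comp_quantError hΔ fun z => z, intervalIntegral.integral_neg, integral_id]
  ring

lemma integral_quantError_sq {a D : Ω → ℝ} {Δ : ℝ} (hΔ : 0 < Δ) (ha : Measurable a)
    (hD : Measurable D) (hunif : pdf.IsUniform D (Set.Ico (-(Δ / 2)) (Δ / 2)) P volume)
    (hind : IndepFun D a P) :
    ∫ ω, quantError Δ (a ω + D ω) * quantError Δ (a ω + D ω) ∂P = Δ ^ 2 / 12 := by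
  have hind' : IndepFun D (fun ω => (a ω, (1 : ℝ))) P :=
    hind.comp (φ := id) (ψ := fun x => (x, (1 : ℝ))) measurable_id (by fun_prop)
  have hm : Measurable fun z => quantError Δ z * quantError Δ z :=
    (measurable_quantError Δ).mul (measurable_quantError Δ)
  have hper : Function.Periodic (fun z => quantError Δ z * quantError Δ z) Δ := fun z => by
    simp only [periodic_quantError hΔ z]
  have h := integral_periodic_dither_mul hΔ ha measurable_const hD hunif hind'
    (integrable_const 1) hm hper (C := Δ / 2 * (Δ / 2)) fun z => by
      rw [abs_mul]
      exact mul_le_mul (abs_quantError_le hΔ z) (abs_quantError_le hΔ z) (abs_nonneg _)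
        (by positivity)
  simp only [mul_one, integral_const, probReal_univ, smul_eq_mul] at h
  rw [h, intervalIntegral_comp_quantError hΔ fun z => z * z]
  have hsq : ∫ z in (-(Δ / 2))..(Δ / 2), -z * -z = Δ ^ 3 / 12 := by
    simp_rw [neg_mul_neg, ← pow_two]
    rw [integral_pow]
    push_cast
    ring
  rw [hsq]
  field_simp

end

/-- If `a` is independent of `(b, c)` and `b` of `c`, then `b` is independent of `(a, c)`. -/
lemma indepFun_prodMk_of_indepFun {Ω α β γ : Type*} [MeasurableSpace Ω] [MeasurableSpace α]
    [MeasurableSpace β] [MeasurableSpace γ] {P : Measure Ω} [IsProbabilityMeasure P]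
    {a : Ω → α} {b : Ω → β} {c : Ω → γ} (ha : Measurable a) (hb : Measurable b)
    (hc : Measurable c) (habc : IndepFun a (fun ω => (b ω, c ω)) P) (hbc : IndepFun b c P) :
    IndepFun b (fun ω => (a ω, c ω)) P := by
  have := Measure.isProbabilityMeasure_map (μ := P) ha.aemeasurable
  have := Measure.isProbabilityMeasure_map (μ := P) hb.aemeasurable
  have := Measure.isProbabilityMeasure_map (μ := P) hc.aemeasurable
  have hac : IndepFun a c P := habc.comp (φ := id) (ψ := Prod.snd) measurable_id measurable_snd
  rw [indepFun_iff_map_prod_eq_prod_map_map hb.aemeasurable (by fun_prop),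
    (indepFun_iff_map_prod_eq_prod_map_map ha.aemeasurable hc.aemeasurable).1 hac]
  have h1 := (indepFun_iff_map_prod_eq_prod_map_map ha.aemeasurable (by fun_prop)).1 habc
  rw [(indepFun_iff_map_prod_eq_prod_map_map hb.aemeasurable hc.aemeasurable).1 hbc] at h1
  have h2 : P.map (fun ω => (b ω, a ω, c ω)) =
      (P.map fun ω => (a ω, b ω, c ω)).map fun z => (z.2.1, z.1, z.2.2) := by
    rw [Measure.map_map (by fun_prop) (by fun_prop)]
    rfl
  rw [h2, h1]
  refine Measure.ext_of_lintegral _ fun f hf => ?_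
  rw [lintegral_map hf (by fun_prop), lintegral_prod _ (by fun_prop),
    lintegral_prod _ (by fun_prop)]
  have e1 : ∀ x, ∫⁻ y : β × γ, f (y.1, x, y.2) ∂((P.map b).prod (P.map c)) =
      ∫⁻ y, ∫⁻ z, f (y, x, z) ∂(P.map c) ∂(P.map b) := fun x =>
    lintegral_prod _ (by fun_prop)
  have e2 : ∀ y, ∫⁻ w : α × γ, f (y, w) ∂((P.map a).prod (P.map c)) =
      ∫⁻ x, ∫⁻ z, f (y, x, z) ∂(P.map c) ∂(P.map a) := fun y =>
    lintegral_prod _ (by fun_prop)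
  simp_rw [e1, e2]
  exact lintegral_lintegral_swap (Measurable.lintegral_prod_right' (f := fun q : (α × β) × γ =>
    f (q.1.2, q.1.1, q.2)) (by fun_prop)).aemeasurable

/-! ### Linear spans, Gaussian conditional means and the normal equations -/

section
variable {Ω Ω' : Type*} [MeasurableSpace Ω] [MeasurableSpace Ω'] {P : Measure Ω} {P' : Measure Ω'}

lemma measurable_of_mem_span {S : Set (Ω → ℝ)} (hS : ∀ f ∈ S, Measurable f) {f : Ω → ℝ}
    (hf : f ∈ Submodule.span ℝ S) : Measurable f := by
  induction hf using Submodule.span_induction with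
  | mem x hx => exact hS x hx
  | zero => exact measurable_const
  | add x y _ _ hx hy => exact hx.add hy
  | smul a x _ hx => exact hx.const_smul a

lemma memLp_pair_of_mem_span {S : Set ((Ω → ℝ) × (Ω' → ℝ))}
    (hS : ∀ p ∈ S, MemLp p.1 2 P ∧ MemLp p.2 2 P') {p : (Ω → ℝ) × (Ω' → ℝ)}
    (hp : p ∈ Submodule.span ℝ S) : MemLp p.1 2 P ∧ MemLp p.2 2 P' := by
  induction hp using Submodule.span_induction with
  | mem x hx => exact hS x hx
  | zero => exact ⟨MemLp.zero, MemLp.zero⟩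
  | add x y _ _ hx hy => exact ⟨hx.1.add hy.1, hx.2.add hy.2⟩
  | smul a x _ hx => exact ⟨hx.1.const_smul a, hx.2.const_smul a⟩

/-- Agreement of mixed second moments extends bilinearly from a set of pairs to its span. -/
lemma integral_mul_eq_of_mem_span {S : Set ((Ω → ℝ) × (Ω' → ℝ))}
    (hS : ∀ p ∈ S, MemLp p.1 2 P ∧ MemLp p.2 2 P')
    (h : ∀ p ∈ S, ∀ q ∈ S, ∫ ω, p.1 ω * q.1 ω ∂P = ∫ ω, p.2 ω * q.2 ω ∂P')
    {p q : (Ω → ℝ) × (Ω' → ℝ)} (hp : p ∈ Submodule.span ℝ S) (hq : q ∈ Submodule.span ℝ S) :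
    ∫ ω, p.1 ω * q.1 ω ∂P = ∫ ω, p.2 ω * q.2 ω ∂P' := by
  have key : ∀ r : (Ω → ℝ) × (Ω' → ℝ), MemLp r.1 2 P ∧ MemLp r.2 2 P' →
      (∀ s ∈ S, ∫ ω, r.1 ω * s.1 ω ∂P = ∫ ω, r.2 ω * s.2 ω ∂P') →
      ∀ s ∈ Submodule.span ℝ S, ∫ ω, r.1 ω * s.1 ω ∂P = ∫ ω, r.2 ω * s.2 ω ∂P' := by
    intro r hr hrs s hs
    induction hs using Submodule.span_induction with
    | mem x hx => exact hrs x hx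
    | zero => simp
    | add x y hx hy hx' hy' =>
      have h1 := memLp_pair_of_mem_span hS hx
      have h2 := memLp_pair_of_mem_span hS hy
      simp only [Prod.fst_add, Prod.snd_add, Pi.add_apply, mul_add]
      have a1 : Integrable (fun ω => r.1 ω * x.1 ω) P := hr.1.integrable_mul h1.1
      have a2 : Integrable (fun ω => r.1 ω * y.1 ω) P := hr.1.integrable_mul h2.1
      have a3 : Integrable (fun ω => r.2 ω * x.2 ω) P' := hr.2.integrable_mul h1.2
      have a4 : Integrable (fun ω => r.2 ω * y.2 ω) P' := hr.2.integrable_mul h2.2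
      rw [integral_add a1 a2, integral_add a3 a4, hx', hy']
    | smul a x _ hx' =>
      simp only [Prod.smul_fst, Prod.smul_snd, Pi.smul_apply, smul_eq_mul, mul_left_comm _ a]
      rw [integral_const_mul, integral_const_mul, hx']
  refine key p (memLp_pair_of_mem_span hS hp) (fun s hs => ?_) q hq
  have := key s (hS s hs) (fun r hr => h s hs r hr) p hp
  simpa only [mul_comm] using this

end

section
variable {Ω : Type*} [MeasurableSpace Ω] {P : Measure Ω}

lemma _root_.ProbabilityTheory.IsGaussianProcess.hasGaussianLaw_of_mem_span {T : Type*}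
    {X : T → Ω → ℝ} (hX : IsGaussianProcess X P) {f : Ω → ℝ}
    (hf : f ∈ Submodule.span ℝ (Set.range X)) : HasGaussianLaw f P := by
  obtain ⟨c, rfl⟩ := Finsupp.mem_span_range_iff_exists_finsupp.1 hf
  have := (hX.smul c).hasGaussianLaw_sum (I := c.support)
  exact this

/-- A random vector all of whose linear images are Gaussian is Gaussian. -/
lemma hasGaussianLaw_of_forall_dual {E : Type*} [NormedAddCommGroup E] [NormedSpace ℝ E]
    [MeasurableSpace E] [BorelSpace E] {X : Ω → E} (hX : AEMeasurable X P)
    (h : ∀ L : StrongDual ℝ E, HasGaussianLaw (fun ω => L (X ω)) P) : HasGaussianLaw X P where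
  isGaussian_map := ⟨fun L => by
    have hL : AEMeasurable L (P.map X) := L.continuous.measurable.aemeasurable
    rw [AEMeasurable.map_map_of_aemeasurable hL hX,
      integral_map hX L.continuous.measurable.aestronglyMeasurable, variance_map hL hX]
    exact (h L).map_eq_gaussianReal⟩

/-- In a Gaussian space `V` of random variables, an observable affine approximation whose error has
mean zero and is uncorrelated with the observations is the conditional mean. -/
lemma condExp_ae_eq_of_gaussian [IsProbabilityMeasure P] {V : Submodule ℝ (Ω → ℝ)}
    (hV : ∀ f ∈ V, HasGaussianLaw f P) {κ : Type*} [Fintype κ] {O : κ → Ω → ℝ}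
    (hO : ∀ k, O k ∈ V) (hOm : ∀ k, Measurable (O k)) {X e : Ω → ℝ} (hX : X ∈ V) (he : e ∈ V)
    (hem : Measurable[MeasurableSpace.comap (fun ω k => O k ω) inferInstance] e)
    (hmean : ∫ ω, (X ω - e ω) ∂P = 0) (hcov : ∀ k, ∫ ω, (X ω - e ω) * O k ω ∂P = 0) :
    P[X | MeasurableSpace.comap (fun ω k => O k ω) inferInstance] =ᵐ[P] e := by
  classical
  have hOv : Measurable fun ω k => O k ω := measurable_pi_lambda _ hOm
  let Z : Ω → ℝ := X - e
  have hZV : Z ∈ V := V.sub_mem hX he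
  have hjoint : HasGaussianLaw (fun ω => (fun _ : Unit => Z ω, fun k => O k ω)) P := by
    refine hasGaussianLaw_of_forall_dual ?_ fun L => ?_
    · exact (aemeasurable_pi_lambda _ fun _ => (hV Z hZV).aemeasurable).prodMk hOv.aemeasurable
    · have hL : (fun ω => L (fun _ : Unit => Z ω, fun k => O k ω)) =
          L (fun _ => 1, 0) • Z + ∑ k, L (0, Pi.single k 1) • O k := by
        ext ω
        have h1 : ((fun _ : Unit => Z ω), fun k => O k ω) =
            Z ω • ((fun _ : Unit => (1 : ℝ)), (0 : κ → ℝ)) +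
              ∑ k, O k ω • ((0 : Unit → ℝ), (Pi.single k 1 : κ → ℝ)) := by
          ext j
          · simp [Prod.fst_sum]
          · simp [Prod.snd_sum, Finset.sum_apply, Pi.single_apply]
        rw [h1, map_add, map_sum, map_smul]
        simp only [map_smul, Pi.add_apply, Pi.smul_apply, Finset.sum_apply, smul_eq_mul, mul_comm]
      rw [hL]
      exact hV _ (V.add_mem (V.smul_mem _ hZV) (V.sum_mem fun k _ => V.smul_mem _ (hO k)))
  have hZ2 : MemLp Z 2 P := (hV Z hZV).memLp_two
  have hind : IndepFun (fun ω (_ : Unit) => Z ω) (fun ω k => O k ω) P :=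
    hjoint.indepFun_of_covariance_eval (X := fun _ => Z) (Y := O) fun _ k => by
      rw [covariance_eq_sub hZ2 (hV _ (hO k)).memLp_two]
      have h1 : P[Z * O k] = 0 := hcov k
      have h2 : P[Z] = 0 := hmean
      rw [h1, h2, zero_mul, sub_zero]
  obtain ⟨Z', hZ'm, hZZ'⟩ := (hV Z hZV).aemeasurable
  have hind' : IndepFun Z' (fun ω k => O k ω) P := by
    have : IndepFun Z (fun ω k => O k ω) P :=
      hind.comp (φ := fun z : Unit → ℝ => z ()) (ψ := id) (measurable_pi_apply _) measurable_id
    exact this.congr hZZ' (ae_eq_refl _)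
  have hZc : P[Z | MeasurableSpace.comap (fun ω k => O k ω) inferInstance] =ᵐ[P] 0 := by
    refine (condExp_congr_ae hZZ').trans ?_
    have h := condExp_indep_eq (m₁ := MeasurableSpace.comap Z' inferInstance)
      (m₂ := MeasurableSpace.comap (fun ω k => O k ω) inferInstance) (μ := P)
      hZ'm.comap_le hOv.comap_le (f := Z')
      (Measurable.stronglyMeasurable (comap_measurable Z')) hind'
    refine h.trans ?_
    rw [← integral_congr_ae hZZ', show ∫ ω, Z ω ∂P = 0 from hmean]
    rfl
  have hei : Integrable e P := (hV e he).integrable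
  have hXe : X = Z + e := by simp [Z]
  rw [hXe]
  refine (condExp_add (hZ2.integrable one_le_two) hei _).trans ?_
  rw [condExp_of_stronglyMeasurable hOv.comap_le (Measurable.stronglyMeasurable hem) hei]
  filter_upwards [hZc] with ω hω
  simp [hω]

/-- Normal equations: the error of a linear minimum mean squared error estimate is orthogonal to
every square-integrable affine function of the data. -/
lemma IsLMMSE.integral_mul_eq_zero {E : Type*} [AddCommGroup E] [Module ℝ E] {n : ℕ}
    {X : Ω → Vec (Fin n)} {Y : Ω → E} {Xhat : Ω → Vec (Fin n)} (h : IsLMMSE P X Y Xhat)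
    (hX : ∀ i, MemLp (fun ω => X ω i) 2 P) (hXhat : ∀ i, MemLp (fun ω => Xhat ω i) 2 P)
    {φ : E →ᵃ[ℝ] ℝ} (hφ : MemLp (fun ω => φ (Y ω)) 2 P) (i : Fin n) :
    ∫ ω, (X ω i - Xhat ω i) * φ (Y ω) ∂P = 0 := by
  obtain ⟨⟨g, hg⟩, hmin⟩ := h
  have hR : ∀ j, MemLp (fun ω => X ω j - Xhat ω j) 2 P := fun j => (hX j).sub (hXhat j)
  have hnorm : Integrable (fun ω => ‖X ω - Xhat ω‖ ^ 2) P := by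
    simp_rw [EuclideanSpace.real_norm_sq_eq]
    exact integrable_finsetSum _ fun j _ => (hR j).integrable_sq
  have hcross : Integrable (fun ω => (X ω i - Xhat ω i) * φ (Y ω)) P := (hR i).integrable_mul hφ
  have hsq : Integrable (fun ω => φ (Y ω) ^ 2) P := hφ.integrable_sq
  set a := ∫ ω, (X ω i - Xhat ω i) * φ (Y ω) ∂P with ha
  set b := ∫ ω, φ (Y ω) ^ 2 ∂P with hb
  have hb0 : 0 ≤ b := integral_nonneg fun _ => sq_nonneg _
  have hquad : ∀ ε : ℝ, 0 ≤ -(2 * ε) * a + ε ^ 2 * b := by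
    intro ε
    let gε : E →ᵃ[ℝ] Vec (Fin n) := g + (LinearMap.toSpanSingleton ℝ (Vec (Fin n))
      (ε • EuclideanSpace.single i (1 : ℝ))).toAffineMap.comp φ
    have hexp : ∀ ω, ‖X ω - gε (Y ω)‖ ^ 2 =
        ‖X ω - Xhat ω‖ ^ 2 + (-(2 * ε) * ((X ω i - Xhat ω i) * φ (Y ω)) +
          ε ^ 2 * φ (Y ω) ^ 2) := by
      intro ω
      have h1 : X ω - gε (Y ω) =
          (X ω - Xhat ω) - (φ (Y ω) * ε) • EuclideanSpace.single i (1 : ℝ) := by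
        simp only [gε, LinearMap.coe_toAffineMap,
          LinearMap.toSpanSingleton_apply, hg ω, Pi.add_apply, AffineMap.coe_add, smul_smul,
          AffineMap.coe_comp, Function.comp_apply]
        abel
      rw [h1, norm_sub_sq_real, inner_smul_right, norm_smul, mul_pow,
        PiLp.norm_single, EuclideanSpace.inner_single_right]
      simp only [Real.norm_eq_abs, sq_abs, norm_one, one_pow, mul_one, PiLp.sub_apply, one_mul,
        RCLike.conj_to_real]
      ring
    have hgε : Integrable (fun ω => ‖X ω - gε (Y ω)‖ ^ 2) P := by
      simp_rw [hexp]
      exact hnorm.add ((hcross.const_mul _).add (hsq.const_mul _))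
    have hle := hmin gε
    have hconv : ∀ Z : Ω → Vec (Fin n), Integrable (fun ω => ‖Z ω‖ ^ 2) P →
        ∫⁻ ω, ‖Z ω‖ₑ ^ 2 ∂P = ENNReal.ofReal (∫ ω, ‖Z ω‖ ^ 2 ∂P) := by
      intro Z hZ
      rw [ofReal_integral_eq_lintegral_ofReal hZ (ae_of_all _ fun _ => sq_nonneg _)]
      congr with ω
      rw [ENNReal.ofReal_pow (norm_nonneg _), ofReal_norm]
    rw [hconv _ hnorm, hconv _ hgε,
      ENNReal.ofReal_le_ofReal_iff (integral_nonneg fun _ => sq_nonneg _)] at hle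
    simp_rw [hexp] at hle
    have hc1 : Integrable (fun ω => -(2 * ε) * ((X ω i - Xhat ω i) * φ (Y ω))) P :=
      hcross.const_mul _
    have hc2 : Integrable (fun ω => ε ^ 2 * φ (Y ω) ^ 2) P := hsq.const_mul _
    have hc3 : Integrable (fun ω => -(2 * ε) * ((X ω i - Xhat ω i) * φ (Y ω)) +
      ε ^ 2 * φ (Y ω) ^ 2) P := hc1.add hc2
    rw [integral_add hnorm hc3, integral_add hc1 hc2, integral_const_mul, integral_const_mul] at hle
    linarith
  have h1 := hquad (a / (b + 1))
  have hb1 : 0 < b + 1 := by linarith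
  have h2 : -(2 * (a / (b + 1))) * a + (a / (b + 1)) ^ 2 * b =
      -(a ^ 2 * (b + 2)) / (b + 1) ^ 2 := by
    field_simp
    ring
  rw [h2, le_div_iff₀ (by positivity), zero_mul] at h1
  have h3 : a ^ 2 ≤ 0 := by nlinarith [sq_nonneg a]
  exact pow_eq_zero_iff two_ne_zero |>.1 (le_antisymm h3 (sq_nonneg a))

end

/-! ### Gaussianity of the driving noise -/

section
variable {Ω : Type*} [MeasurableSpace Ω] {P : Measure Ω}

lemma isGaussianProcess_coord {κ : Type} [Fintype κ] {x : Ω → Vec κ} (hx : HasGaussianLaw x P) :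
    IsGaussianProcess (fun i ω => x ω i) P where
  hasGaussianLaw I := hx.map
    (ContinuousLinearMap.pi fun i : I => (EuclideanSpace.proj (𝕜 := ℝ) (i : κ) : Vec κ →L[ℝ] ℝ))

lemma isGaussianProcess_coord_of_iIndepFun {T : Type*} {κ : Type} [Fintype κ]
    {w : T → Ω → Vec κ} (hw : ∀ t, HasGaussianLaw (w t) P) (hind : iIndepFun w P) :
    IsGaussianProcess (fun (ti : T × κ) ω => w ti.1 ω ti.2) P := by
  have hwp : IsGaussianProcess w P :=
    ⟨fun I => iIndepFun.hasGaussianLaw (X := fun i : I => w i) (fun i => hw i)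
      (hind.precomp Subtype.val_injective)⟩
  exact hwp.of_isGaussianProcess fun ti => ⟨{ti.1},
    (EuclideanSpace.proj (𝕜 := ℝ) ti.2 : Vec κ →L[ℝ] ℝ).comp
      (ContinuousLinearMap.proj ⟨ti.1, by simp⟩), fun ω => rfl⟩

/-- Independence passes to variables that are measurable with respect to the two data. -/
lemma indepFun_of_measurable_comap {α β γ δ : Type*} {mα : MeasurableSpace α}
    {mβ : MeasurableSpace β} {mγ : MeasurableSpace γ} {mδ : MeasurableSpace δ} {a : Ω → α}
    {b : Ω → β} {f : Ω → γ} {g : Ω → δ}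
    (h : IndepFun a b P) (hf : Measurable[MeasurableSpace.comap a mα] f)
    (hg : Measurable[MeasurableSpace.comap b mβ] g) : IndepFun f g P :=
  indep_of_indep_of_le_left (indep_of_indep_of_le_right h hg.comap_le) hf.comap_le

lemma _root_.ProbabilityTheory.HasGaussianLaw.add_of_indepFun {f g : Ω → ℝ}
    (hf : HasGaussianLaw f P) (hg : HasGaussianLaw g P) (h : IndepFun f g P) :
    HasGaussianLaw (f + g) P := (IndepFun.hasGaussianLaw hf hg h).add

lemma _root_.ProbabilityTheory.HasGaussianLaw.add_const {f : Ω → ℝ} (hf : HasGaussianLaw f P)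
    (c : ℝ) : HasGaussianLaw (fun ω => f ω + c) P where
  isGaussian_map := by
    have := hf.isGaussian_map
    have h : P.map (fun ω => f ω + c) = (P.map f).map (fun x => x + c) := by
      rw [AEMeasurable.map_map_of_aemeasurable (by fun_prop) hf.aemeasurable]
      rfl
    rw [h]
    infer_instance

/-- Linear combinations of the initial state, the plant noise and the sensor noise are Gaussian. -/
lemma hasGaussianLaw_of_mem_span_sum {κ κ' : Type} [Fintype κ] [Fintype κ'] {x₀ : Ω → Vec κ}
    {w : ℕ → Ω → Vec κ} {v : ℕ → Ω → Vec κ'} (hx : HasGaussianLaw x₀ P)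
    (hw : ∀ t, HasGaussianLaw (w t) P) (hv : ∀ t, HasGaussianLaw (v t) P) (hwi : iIndepFun w P)
    (hvi : iIndepFun v P) (hxw : IndepFun x₀ (fun ω t => w t ω) P)
    (hxwv : IndepFun (fun ω => (x₀ ω, fun t => w t ω)) (fun ω t => v t ω) P) {f g h : Ω → ℝ}
    (hf : f ∈ Submodule.span ℝ (Set.range fun i ω => x₀ ω i))
    (hg : g ∈ Submodule.span ℝ (Set.range fun (ti : ℕ × κ) ω => w ti.1 ω ti.2))
    (hh : h ∈ Submodule.span ℝ (Set.range fun (ti : ℕ × κ') ω => v ti.1 ω ti.2)) :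
    HasGaussianLaw (f + g + h) P := by
  have hfm : Measurable[MeasurableSpace.comap x₀ inferInstance] f := by
    let _ := MeasurableSpace.comap x₀ inferInstance
    refine measurable_of_mem_span ?_ hf
    rintro _ ⟨i, rfl⟩
    exact (EuclideanSpace.proj (𝕜 := ℝ) i).continuous.measurable.comp (comap_measurable x₀)
  have hgm : Measurable[MeasurableSpace.comap (fun ω t => w t ω) inferInstance] g := by
    let _ := MeasurableSpace.comap (fun ω t => w t ω) inferInstance
    refine measurable_of_mem_span ?_ hg
    rintro _ ⟨ti, rfl⟩
    exact (EuclideanSpace.proj (𝕜 := ℝ) ti.2).continuous.measurable.comp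
      ((measurable_pi_apply ti.1).comp (comap_measurable fun ω t => w t ω))
  have hhm : Measurable[MeasurableSpace.comap (fun ω t => v t ω) inferInstance] h := by
    let _ := MeasurableSpace.comap (fun ω t => v t ω) inferInstance
    refine measurable_of_mem_span ?_ hh
    rintro _ ⟨ti, rfl⟩
    exact (EuclideanSpace.proj (𝕜 := ℝ) ti.2).continuous.measurable.comp
      ((measurable_pi_apply ti.1).comp (comap_measurable fun ω t => v t ω))
  have h1 : HasGaussianLaw (f + g) P :=
    ((isGaussianProcess_coord hx).hasGaussianLaw_of_mem_span hf).add_of_indepFun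
      ((isGaussianProcess_coord_of_iIndepFun hw hwi).hasGaussianLaw_of_mem_span hg)
      (indepFun_of_measurable_comap hxw hfm hgm)
  have hfg : Measurable[MeasurableSpace.comap (fun ω => (x₀ ω, fun t => w t ω)) inferInstance]
      (f + g) := by
    have hc := comap_measurable (m := inferInstance) (fun ω => (x₀ ω, fun t => w t ω))
    have e1 : MeasurableSpace.comap x₀ inferInstance ≤
        MeasurableSpace.comap (fun ω => (x₀ ω, fun t => w t ω)) inferInstance :=
      (measurable_fst.comp hc).comap_le
    have e2 : MeasurableSpace.comap (fun ω t => w t ω) inferInstance ≤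
        MeasurableSpace.comap (fun ω => (x₀ ω, fun t => w t ω)) inferInstance :=
      (measurable_snd.comp hc).comap_le
    exact (hfm.mono e1 le_rfl).add (hgm.mono e2 le_rfl)
  exact h1.add_of_indepFun
    ((isGaussianProcess_coord_of_iIndepFun hv hvi).hasGaussianLaw_of_mem_span hh)
    (indepFun_of_measurable_comap hxwv hfg hhm)

end

/-! ### Coordinates and measurability -/

section
variable {n m : ℕ} {ι κ : Type} [Fintype κ]

lemma act_apply (M : Matrix ι κ ℝ) (v : Vec κ) (i : ι) : act M v i = ∑ j, M i j * v j := rfl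

lemma act_sub (M : Matrix ι κ ℝ) (v w : Vec κ) : act M (v - w) = act M v - act M w := by
  ext i
  simp [act_apply, mul_sub, Finset.sum_sub_distrib]

section
variable {Ω : Type*} {mΩ : MeasurableSpace Ω}

lemma measurable_vec_iff {ι : Type} {f : Ω → Vec ι} :
    Measurable f ↔ ∀ i, Measurable fun ω => f ω i := by
  constructor
  · intro h i
    exact (measurable_pi_apply i).comp ((WithLp.measurable_ofLp 2 _).comp h)
  · intro h
    exact (WithLp.measurable_toLp 2 _).comp (measurable_pi_lambda (fun ω i => f ω i) h)

lemma measurable_act {M : Matrix ι κ ℝ} {f : Ω → Vec κ} (hf : Measurable f) :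
    Measurable fun ω => act M (f ω) := by
  rw [measurable_vec_iff] at hf ⊢
  intro i
  simp only [act_apply]
  exact Finset.measurable_sum _ fun j _ => (hf j).const_mul _

lemma measurable_fstBlock {f : Ω → Vec (Fin n ⊕ Fin m)} (hf : Measurable f) :
    Measurable fun ω => fstBlock (f ω) := by
  rw [measurable_vec_iff] at hf ⊢
  exact fun i => hf _

lemma measurable_sndBlock {f : Ω → Vec (Fin n ⊕ Fin m)} (hf : Measurable f) :
    Measurable fun ω => sndBlock (f ω) := by
  rw [measurable_vec_iff] at hf ⊢
  exact fun i => hf _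

lemma measurable_stack {f : Ω → Vec (Fin n)} {g : Ω → Vec (Fin m)} (hf : Measurable f)
    (hg : Measurable g) : Measurable fun ω => stack (f ω) (g ω) := by
  rw [measurable_vec_iff] at hf hg ⊢
  rintro (i | j)
  · exact hf i
  · exact hg j

lemma measurable_observed {y : ℕ → Ω → Vec (Fin n)} {x : ℕ → Ω → Vec (Fin n ⊕ Fin m)} {s t : ℕ}
    (hy : ∀ k < s, Measurable (y k)) (hx : ∀ k < t, Measurable (x k)) :
    Measurable (observed y x s t) :=
  (measurable_pi_lambda _ fun k : Fin s => hy k k.2).prodMk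
    (measurable_pi_lambda _ fun k : Fin t => measurable_sndBlock (hx k k.2))

lemma measurable_affineMap {s t : ℕ}
    (g : ((Fin s → Vec (Fin n)) × (Fin t → Vec (Fin m))) →ᵃ[ℝ] Vec (Fin n)) : Measurable g :=
  g.continuous_of_finiteDimensional.measurable

end

/-! ### Affine functions of the data -/

/-- The scalar entries of the data: the first `s` measurements and the first `t` values of the side
information. -/
def obsCoord {Ω : Type*} (y : ℕ → Ω → Vec (Fin n)) (x : ℕ → Ω → Vec (Fin n ⊕ Fin m)) (s t : ℕ) :
    (Fin s × Fin n) ⊕ (Fin t × Fin m) → Ω → ℝ :=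
  Sum.elim (fun ki ω => y ki.1 ω ki.2) (fun ji ω => x ji.1 ω (Sum.inr ji.2))

/-- The space of all scalar affine functions of the data. -/
def obsSpan {Ω : Type*} (y : ℕ → Ω → Vec (Fin n)) (x : ℕ → Ω → Vec (Fin n ⊕ Fin m)) (s t : ℕ) :
    Submodule ℝ (Ω → ℝ) :=
  Submodule.span ℝ (insert 1 (Set.range (obsCoord y x s t)))

section
variable {Ω : Type*} {y : ℕ → Ω → Vec (Fin n)} {x : ℕ → Ω → Vec (Fin n ⊕ Fin m)} {s t : ℕ}

lemma one_mem_obsSpan : (1 : Ω → ℝ) ∈ obsSpan y x s t :=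
  Submodule.subset_span (Set.mem_insert _ _)

lemma obsCoord_mem_obsSpan (k) : obsCoord y x s t k ∈ obsSpan y x s t :=
  Submodule.subset_span (Set.mem_insert_of_mem _ ⟨k, rfl⟩)

lemma meas_mem_obsSpan {k : ℕ} (hk : k < s) (i : Fin n) :
    (fun ω => y k ω i) ∈ obsSpan y x s t :=
  obsCoord_mem_obsSpan (y := y) (x := x) (s := s) (t := t) (Sum.inl (⟨k, hk⟩, i))

lemma side_mem_obsSpan {k : ℕ} (hk : k < t) (j : Fin m) :
    (fun ω => x k ω (Sum.inr j)) ∈ obsSpan y x s t :=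
  obsCoord_mem_obsSpan (y := y) (x := x) (s := s) (t := t) (Sum.inr (⟨k, hk⟩, j))

lemma obsSpan_le_iff {V : Submodule ℝ (Ω → ℝ)} :
    obsSpan y x s t ≤ V ↔ 1 ∈ V ∧ (∀ k < s, ∀ i, (fun ω => y k ω i) ∈ V) ∧
      ∀ k < t, ∀ j, (fun ω => x k ω (Sum.inr j)) ∈ V := by
  constructor
  · exact fun h => ⟨h one_mem_obsSpan, fun k hk i => h (meas_mem_obsSpan hk i),
      fun k hk j => h (side_mem_obsSpan hk j)⟩
  · rintro ⟨h1, h2, h3⟩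
    rw [obsSpan, Submodule.span_le]
    rintro f (rfl | ⟨⟨k, i⟩ | ⟨k, j⟩, rfl⟩)
    · exact h1
    · exact h2 k k.2 i
    · exact h3 k k.2 j

lemma obsSpan_mono {s' t' : ℕ} (hs : s ≤ s') (ht : t ≤ t') :
    obsSpan y x s t ≤ obsSpan y x s' t' :=
  obsSpan_le_iff.2 ⟨one_mem_obsSpan, fun _ hk i => meas_mem_obsSpan (hk.trans_le hs) i,
    fun _ hk j => side_mem_obsSpan (hk.trans_le ht) j⟩

lemma affine_comp_observed_mem_obsSpan
    (φ : ((Fin s → Vec (Fin n)) × (Fin t → Vec (Fin m))) →ᵃ[ℝ] ℝ) :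
    (fun ω => φ (observed y x s t ω)) ∈ obsSpan y x s t := by
  have hdec : ∀ z : (Fin s → Vec (Fin n)) × (Fin t → Vec (Fin m)),
      z = ∑ k, ∑ i, z.1 k i • ((Pi.single k (EuclideanSpace.single i (1 : ℝ)), 0) :
          (Fin s → Vec (Fin n)) × (Fin t → Vec (Fin m))) +
        ∑ k, ∑ j, z.2 k j • ((0, Pi.single k (EuclideanSpace.single j (1 : ℝ))) :
          (Fin s → Vec (Fin n)) × (Fin t → Vec (Fin m))) := by
    intro z
    ext k i
    · simp [Prod.fst_sum, Finset.sum_apply, Pi.single_apply, apply_ite]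
    · simp [Prod.snd_sum, Finset.sum_apply, Pi.single_apply, apply_ite]
  have hφ : (fun ω => φ (observed y x s t ω)) =
      (∑ k : Fin s, ∑ i, φ.linear (Pi.single k (EuclideanSpace.single i (1 : ℝ)), 0) •
          (fun ω => y k ω i) +
        ∑ k : Fin t, ∑ j, φ.linear (0, Pi.single k (EuclideanSpace.single j (1 : ℝ))) •
          (fun ω => x k ω (Sum.inr j))) + φ 0 • (1 : Ω → ℝ) := by
    ext ω
    have h0 : φ (observed y x s t ω) = φ.linear (observed y x s t ω) + φ 0 :=
      congrFun (AffineMap.decomp φ) _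
    rw [h0, hdec (observed y x s t ω)]
    simp only [map_add, map_sum, map_smul, Pi.add_apply, Finset.sum_apply, Pi.smul_apply,
      smul_eq_mul, Pi.one_apply, one_mul, mul_comm]
    rfl
  rw [hφ]
  refine Submodule.add_mem _ (Submodule.add_mem _ ?_ ?_) (Submodule.smul_mem _ _ one_mem_obsSpan)
  · exact Submodule.sum_mem _ fun k _ => Submodule.sum_mem _ fun i _ =>
      Submodule.smul_mem _ _ (meas_mem_obsSpan k.2 i)
  · exact Submodule.sum_mem _ fun k _ => Submodule.sum_mem _ fun j _ =>
      Submodule.smul_mem _ _ (side_mem_obsSpan k.2 j)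

lemma exists_affine_of_mem_obsSpan {f : Ω → ℝ} (hf : f ∈ obsSpan y x s t) :
    ∃ φ : ((Fin s → Vec (Fin n)) × (Fin t → Vec (Fin m))) →ᵃ[ℝ] ℝ,
      f = fun ω => φ (observed y x s t ω) := by
  induction hf using Submodule.span_induction with
  | mem f hf =>
    rcases hf with rfl | ⟨⟨k, i⟩ | ⟨k, j⟩, rfl⟩
    · exact ⟨AffineMap.const ℝ _ 1, rfl⟩
    · exact ⟨((EuclideanSpace.proj (𝕜 := ℝ) i : Vec (Fin n) →L[ℝ] ℝ).toLinearMap ∘ₗ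
        LinearMap.proj k ∘ₗ LinearMap.fst ℝ _ _).toAffineMap, rfl⟩
    · exact ⟨((EuclideanSpace.proj (𝕜 := ℝ) j : Vec (Fin m) →L[ℝ] ℝ).toLinearMap ∘ₗ
        LinearMap.proj k ∘ₗ LinearMap.snd ℝ _ _).toAffineMap, rfl⟩
  | zero => exact ⟨0, rfl⟩
  | add f g _ _ hf hg =>
    obtain ⟨φ, rfl⟩ := hf
    obtain ⟨ψ, rfl⟩ := hg
    exact ⟨φ + ψ, rfl⟩
  | smul a f _ hf =>
    obtain ⟨φ, rfl⟩ := hf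
    exact ⟨a • φ, rfl⟩

/-- Adding to each measurement an affine function of the data that precede it does not change the
space of affine functions of the data. -/
lemma obsSpan_eq_of_shift {y' e : ℕ → Ω → Vec (Fin n)} (hy' : ∀ k ω, y' k ω = y k ω + e k ω)
    (he : ∀ k i, (fun ω => e k ω i) ∈ obsSpan y x k (k + 1)) (hst : s ≤ t) :
    obsSpan y' x s t = obsSpan y x s t := by
  apply le_antisymm
  · refine obsSpan_le_iff.2 ⟨one_mem_obsSpan, fun k hk i => ?_, fun k hk j => side_mem_obsSpan hk j⟩
    have : (fun ω => y' k ω i) = (fun ω => y k ω i) + fun ω => e k ω i := by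
      ext ω; simp [hy']
    rw [this]
    exact Submodule.add_mem _ (meas_mem_obsSpan hk i) (obsSpan_mono hk.le (by omega) (he k i))
  · have key : ∀ k : ℕ, obsSpan y x k (k + 1) ≤ obsSpan y' x k (k + 1) ∧
        ∀ i, (fun ω => y k ω i) ∈ obsSpan y' x (k + 1) (k + 1) := by
      intro k
      induction k using Nat.strong_induction_on with
      | _ k ih =>
        have h1 : obsSpan y x k (k + 1) ≤ obsSpan y' x k (k + 1) :=
          obsSpan_le_iff.2 ⟨one_mem_obsSpan,
            fun l hl i => obsSpan_mono (by omega) (by omega) ((ih l hl).2 i),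
            fun l hl j => side_mem_obsSpan hl j⟩
        refine ⟨h1, fun i => ?_⟩
        have : (fun ω => y k ω i) = (fun ω => y' k ω i) - fun ω => e k ω i := by
          ext ω; simp [hy']
        rw [this]
        exact Submodule.sub_mem _ (meas_mem_obsSpan (by omega) i)
          (obsSpan_mono (by omega) le_rfl (h1 (he k i)))
    exact obsSpan_le_iff.2 ⟨one_mem_obsSpan,
      fun k hk i => obsSpan_mono (by omega) (by omega) ((key k).2 i),
      fun k hk j => side_mem_obsSpan hk j⟩

lemma comap_observed_eq :
    MeasurableSpace.comap (observed y x s t) inferInstance =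
      MeasurableSpace.comap (fun ω k => obsCoord y x s t k ω) inferInstance := by
  apply le_antisymm
  · let _ := MeasurableSpace.comap (fun ω k => obsCoord y x s t k ω) inferInstance
    have h : ∀ k, Measurable (obsCoord y x s t k) := fun k =>
      (measurable_pi_apply k).comp (comap_measurable (fun ω k => obsCoord y x s t k ω))
    exact ((measurable_pi_lambda _ fun k : Fin s => measurable_vec_iff.2 fun i =>
      h (Sum.inl (k, i))).prodMk (measurable_pi_lambda _ fun k : Fin t =>
        measurable_vec_iff.2 fun j => h (Sum.inr (k, j)))).comap_le
  · let _ := MeasurableSpace.comap (observed y x s t) inferInstance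
    have h : Measurable (observed y x s t) := comap_measurable _
    refine (measurable_pi_lambda (fun ω k => obsCoord y x s t k ω) ?_).comap_le
    rintro (⟨k, i⟩ | ⟨k, j⟩)
    · exact measurable_vec_iff.1 ((measurable_pi_apply k).comp (measurable_fst.comp h)) i
    · exact measurable_vec_iff.1 ((measurable_pi_apply k).comp (measurable_snd.comp h)) j

end

end

/-! ### Coupled spaces of random variables -/

section
variable {Ω Ω' : Type*}

/-- Two random vectors, on possibly different sample spaces, are coupled by a space `V` of pairs of
random variables if corresponding entries form pairs of `V`. -/
def Coupled (V : Submodule ℝ ((Ω → ℝ) × (Ω' → ℝ))) {ι : Type} (X : Ω → Vec ι) (X' : Ω' → Vec ι) :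
    Prop :=
  ∀ i, ((fun ω => X ω i, fun ω => X' ω i) : (Ω → ℝ) × (Ω' → ℝ)) ∈ V

variable {V : Submodule ℝ ((Ω → ℝ) × (Ω' → ℝ))}

lemma Coupled.add {ι : Type} {X Y : Ω → Vec ι} {X' Y' : Ω' → Vec ι} (hX : Coupled V X X')
    (hY : Coupled V Y Y') : Coupled V (fun ω => X ω + Y ω) (fun ω => X' ω + Y' ω) :=
  fun i => V.add_mem (hX i) (hY i)

lemma Coupled.sub {ι : Type} {X Y : Ω → Vec ι} {X' Y' : Ω' → Vec ι} (hX : Coupled V X X')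
    (hY : Coupled V Y Y') : Coupled V (fun ω => X ω - Y ω) (fun ω => X' ω - Y' ω) :=
  fun i => V.sub_mem (hX i) (hY i)

lemma Coupled.act {ι κ : Type} [Fintype κ] (M : Matrix ι κ ℝ) {X : Ω → Vec κ} {X' : Ω' → Vec κ}
    (hX : Coupled V X X') : Coupled V (fun ω => act M (X ω)) (fun ω => act M (X' ω)) := by
  intro i
  have h : ((fun ω => DitheredLQG.act M (X ω) i, fun ω => DitheredLQG.act M (X' ω) i) :
      (Ω → ℝ) × (Ω' → ℝ)) = ∑ j, M i j • (fun ω => X ω j, fun ω => X' ω j) := by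
    ext ω
    · simp [Prod.fst_sum, act_apply, Finset.sum_apply]
    · simp [Prod.snd_sum, act_apply, Finset.sum_apply]
  rw [h]
  exact V.sum_mem fun j _ => V.smul_mem _ (hX j)

lemma Coupled.continuousLinearMap {ι : Type} [Fintype ι] {X : Ω → Vec ι} {X' : Ω' → Vec ι}
    (hX : Coupled V X X') (L : Vec ι →L[ℝ] Vec ι) :
    Coupled V (fun ω => L (X ω)) (fun ω => L (X' ω)) := by
  classical
  have hL : ∀ v, L v =
      DitheredLQG.act (Matrix.of fun i j => L (EuclideanSpace.single j 1) i) v := by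
    intro v
    have hdec : v = ∑ i, v i • EuclideanSpace.single i (1 : ℝ) := by
      ext j
      simp [Pi.single_apply, Finset.sum_apply]
    conv_lhs => rw [hdec, map_sum]
    ext i
    simp [act_apply, Finset.sum_apply, mul_comm]
  rw [show (fun ω => L (X ω)) = _ from funext fun ω => hL (X ω),
    show (fun ω => L (X' ω)) = _ from funext fun ω => hL (X' ω)]
  exact hX.act _

lemma Coupled.fstBlock {n m : ℕ} {X : Ω → Vec (Fin n ⊕ Fin m)} {X' : Ω' → Vec (Fin n ⊕ Fin m)}
    (hX : Coupled V X X') : Coupled V (fun ω => fstBlock (X ω)) (fun ω => fstBlock (X' ω)) :=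
  fun i => hX (Sum.inl i)

lemma Coupled.sndBlock {n m : ℕ} {X : Ω → Vec (Fin n ⊕ Fin m)} {X' : Ω' → Vec (Fin n ⊕ Fin m)}
    (hX : Coupled V X X') : Coupled V (fun ω => sndBlock (X ω)) (fun ω => sndBlock (X' ω)) :=
  fun i => hX (Sum.inr i)

lemma Coupled.stack {n m : ℕ} {X : Ω → Vec (Fin n)} {X' : Ω' → Vec (Fin n)} {Y : Ω → Vec (Fin m)}
    {Y' : Ω' → Vec (Fin m)} (hX : Coupled V X X') (hY : Coupled V Y Y') :
    Coupled V (fun ω => stack (X ω) (Y ω)) (fun ω => stack (X' ω) (Y' ω)) := by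
  rintro (i | j)
  · exact hX i
  · exact hY j

end

section
variable {Ω Ω' : Type*} [MeasurableSpace Ω] [MeasurableSpace Ω']

/-- A linear space of pairs of random variables, the first of each pair living on `Ω` and Gaussian,
such that mixed second moments of first components agree with those of second components. Constants
belong to it, so means agree as well; `null_mem` lets first components be modified on null sets,
since conditional means are only defined up to null sets. -/
structure IsCoupledSpace (P : Measure Ω) (P' : Measure Ω')
    (V : Submodule ℝ ((Ω → ℝ) × (Ω' → ℝ))) : Prop where
  gaussian : ∀ p ∈ V, HasGaussianLaw p.1 P
  memLp : ∀ p ∈ V, MemLp p.2 2 P'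
  moments : ∀ p ∈ V, ∀ q ∈ V, ∫ ω, p.1 ω * q.1 ω ∂P = ∫ ω, p.2 ω * q.2 ω ∂P'
  one_mem : (1, 1) ∈ V
  null_mem : ∀ f : Ω → ℝ, f =ᵐ[P] 0 → (f, 0) ∈ V

variable {P : Measure Ω} {P' : Measure Ω'} {V : Submodule ℝ ((Ω → ℝ) × (Ω' → ℝ))}

lemma IsCoupledSpace.memLp_fst (hV : IsCoupledSpace P P' V) {p : (Ω → ℝ) × (Ω' → ℝ)}
    (hp : p ∈ V) : MemLp p.1 2 P := (hV.gaussian p hp).memLp_two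

/-- Estimates of coupled vectors from coupled data are coupled: the linear estimate on `Ω'` is an
affine function of the data, the same function applied on `Ω` satisfies the normal equations because
second moments agree, and there Gaussianity makes it the conditional mean. The data `y'` of the
linear estimate may differ from the coupled data `y''`, as long as they span the same affine
functions. -/
lemma IsCoupledSpace.coupled_estimate [IsProbabilityMeasure P] [IsProbabilityMeasure P']
    (hV : IsCoupledSpace P P' V) {n m s t : ℕ}
    {y : ℕ → Ω → Vec (Fin n)} {x : ℕ → Ω → Vec (Fin n ⊕ Fin m)}
    {y' y'' : ℕ → Ω' → Vec (Fin n)} {x' : ℕ → Ω' → Vec (Fin n ⊕ Fin m)}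
    (hym : ∀ k < s, Measurable (y k)) (hxm : ∀ k < t, Measurable (x k))
    (hy : ∀ k < s, Coupled V (y k) (y'' k)) (hx : ∀ k < t, Coupled V (x k) (x' k))
    (hspan : obsSpan y'' x' s t = obsSpan y' x' s t)
    {X Xhat : Ω → Vec (Fin n)} {X' Xhat' : Ω' → Vec (Fin n)} (hX : Coupled V X X')
    (hXhat : Xhat =ᵐ[P] P[X | MeasurableSpace.comap (observed y x s t) inferInstance])
    (hXhat' : IsLMMSE P' X' (observed y' x' s t) Xhat') : Coupled V Xhat Xhat' := by
  let O : Submodule ℝ ((Ω → ℝ) × (Ω' → ℝ)) := Submodule.span ℝ (insert (1, 1)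
    (Set.range fun k => (obsCoord y x s t k, obsCoord y'' x' s t k)))
  have hpair : ∀ k, (obsCoord y x s t k, obsCoord y'' x' s t k) ∈ V := by
    rintro (⟨k, i⟩ | ⟨k, j⟩)
    · exact hy k k.2 i
    · exact hx k k.2 (Sum.inr j)
  have hOV : O ≤ V := by
    rw [Submodule.span_le]
    rintro p (rfl | ⟨k, rfl⟩)
    · exact hV.one_mem
    · exact hpair k
  have hO2 : O.map (LinearMap.snd ℝ (Ω → ℝ) (Ω' → ℝ)) = obsSpan y' x' s t := by
    rw [← hspan, Submodule.map_span, Set.image_insert_eq, ← Set.range_comp]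
    rfl
  have hcoord : ∀ k, Measurable (obsCoord y x s t k) := by
    rintro (⟨k, i⟩ | ⟨k, j⟩)
    · exact measurable_vec_iff.1 (hym k k.2) i
    · exact measurable_vec_iff.1 (hxm k k.2) (Sum.inr j)
  -- entries of the linear estimate, and the matching random variables on `Ω`
  have hmem : ∀ i, (fun ω => Xhat' ω i) ∈ obsSpan y' x' s t := by
    intro i
    obtain ⟨g, hg⟩ := hXhat'.1
    have h := affine_comp_observed_mem_obsSpan (y := y') (x := x')
      ((EuclideanSpace.proj (𝕜 := ℝ) i : Vec (Fin n) →L[ℝ] ℝ).toLinearMap.toAffineMap.comp g)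
    convert h using 2 with ω
    rw [hg]
    rfl
  have hX'2 : ∀ i, MemLp (fun ω => X' ω i) 2 P' := fun i => hV.memLp _ (hX i)
  have hobs2 : ∀ f ∈ obsSpan y' x' s t, MemLp f 2 P' := by
    intro f hf
    rw [← hO2] at hf
    obtain ⟨p, hp, rfl⟩ := hf
    exact hV.memLp p (hOV hp)
  intro i
  have hi := hmem i
  rw [← hO2] at hi
  obtain ⟨⟨e, e'⟩, he, he'⟩ := hi
  simp only [LinearMap.snd_apply] at he'
  subst he'
  have horth : ∀ p ∈ O, ∫ ω, (X ω i - e ω) * p.1 ω ∂P = 0 := by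
    intro p hp
    have hp2 : p.2 ∈ obsSpan y' x' s t := hO2 ▸ Submodule.mem_map_of_mem hp
    have h1 := hV.moments _ (V.sub_mem (hX i) (hOV he)) p (hOV hp)
    refine h1.trans ?_
    obtain ⟨φ, hφ⟩ := exists_affine_of_mem_obsSpan hp2
    have hφ2 : MemLp (fun ω => φ (observed y' x' s t ω)) 2 P' := hφ ▸ hobs2 _ hp2
    have h2 := hXhat'.integral_mul_eq_zero hX'2 (fun j => hobs2 _ (hmem j)) hφ2 i
    simp only [hφ]
    exact h2
  have hem : Measurable[MeasurableSpace.comap (fun ω k => obsCoord y x s t k ω) inferInstance]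
      e := by
    let _ := MeasurableSpace.comap (fun ω k => obsCoord y x s t k ω) inferInstance
    have he1 : e ∈ Submodule.span ℝ (insert 1 (Set.range (obsCoord y x s t))) := by
      have : e ∈ O.map (LinearMap.fst ℝ (Ω → ℝ) (Ω' → ℝ)) := ⟨_, he, rfl⟩
      rw [Submodule.map_span, Set.image_insert_eq, ← Set.range_comp] at this
      exact this
    refine measurable_of_mem_span ?_ he1
    rintro f (rfl | ⟨k, rfl⟩)
    · exact measurable_const
    · exact (measurable_pi_apply k).comp (comap_measurable (fun ω k => obsCoord y x s t k ω))
  have hce := condExp_ae_eq_of_gaussian (P := P) (V := V.map (LinearMap.fst ℝ (Ω → ℝ) (Ω' → ℝ)))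
    (by rintro f ⟨p, hp, rfl⟩; exact hV.gaussian p hp) (O := obsCoord y x s t)
    (fun k => ⟨_, hpair k, rfl⟩) hcoord (X := fun ω => X ω i) (e := e) ⟨_, hX i, rfl⟩
    ⟨_, hOV he, rfl⟩ hem
    (by simpa using horth _ (Submodule.subset_span (Set.mem_insert _ _)))
    (fun k => horth _ (Submodule.subset_span (Set.mem_insert_of_mem _ ⟨k, rfl⟩)))
  rw [← comap_observed_eq] at hce
  have hXint : Integrable X P := by
    have h : ∀ j, Integrable (fun ω => X ω j) P := fun j =>
      (hV.memLp_fst (hX j)).integrable one_le_two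
    exact Integrable.of_eval_piLp h
  have hproj := ContinuousLinearMap.comp_condExp_comm
    (m := MeasurableSpace.comap (observed y x s t) inferInstance) hXint
    (EuclideanSpace.proj (𝕜 := ℝ) i : Vec (Fin n) →L[ℝ] ℝ)
  have hfin : (fun ω => Xhat ω i) - e =ᵐ[P] 0 := by
    filter_upwards [hXhat, hproj, hce] with ω h1 h2 h3
    have h4 : (P[X | MeasurableSpace.comap (observed y x s t) inferInstance] ω) i = e ω :=
      h2.trans h3
    simp [h1, h4]
  have hsum : ((fun ω => Xhat ω i, fun ω => Xhat' ω i) : (Ω → ℝ) × (Ω' → ℝ)) =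
      (e, fun ω => Xhat' ω i) + ((fun ω => Xhat ω i) - e, 0) := by
    ext ω <;> simp
  rw [hsum]
  exact V.add_mem (hOV he) (hV.null_mem _ hfin)

end

/-! ### Measurability of the loops -/

section
variable {n m p : ℕ} {S : System n m p}

lemma sens_pos : 0 < sens := by unfold sens; positivity

lemma sens_sq : sens ^ 2 = 12 := by
  rw [sens, mul_pow, Real.sq_sqrt (by norm_num)]; norm_num

lemma GaussianLoop.measurable_x {Ω : Type*} [MeasurableSpace Ω] {P : Measure Ω}
    (G : GaussianLoop S P) (t : ℕ) : Measurable (G.x t) := by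
  induction t with
  | zero => exact G.measurable_x_zero
  | succ t ih =>
    rw [show G.x (t + 1) = _ from funext (G.plant t)]
    have hu : Measurable (G.u t) := by
      rw [show G.u t = _ from funext (G.control t)]
      exact measurable_act (measurable_stack (G.measurable_xhat t) (measurable_sndBlock ih))
    exact ((measurable_act ih).add (measurable_act hu)).add (G.measurable_w t)

lemma GaussianLoop.measurable_y {Ω : Type*} [MeasurableSpace Ω] {P : Measure Ω}
    (G : GaussianLoop S P) (t : ℕ) : Measurable (G.y t) := by
  rw [show G.y t = _ from funext (G.sensor t)]
  exact (measurable_act (measurable_fstBlock (G.measurable_x t))).add (G.measurable_v t)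

lemma GaussianLoop.measurable_rtil {Ω : Type*} [MeasurableSpace Ω] {P : Measure Ω}
    (G : GaussianLoop S P) (t : ℕ) : Measurable (G.rtil t) :=
  (measurable_fstBlock (G.measurable_x t)).sub (G.measurable_xtil t)

variable {Ω : Type*}

lemma measurable_act_fstBlock_sub [MeasurableSpace Ω] {M : Matrix (Fin n) (Fin n) ℝ}
    {x : Ω → Vec (Fin n ⊕ Fin m)} {e : Ω → Vec (Fin n)} (hx : Measurable x) (he : Measurable e) :
    Measurable fun ω => act M (fstBlock (x ω) - e ω) :=
  measurable_act ((measurable_fstBlock hx).sub he)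

/-- The recursion of the dithered loop preserves measurability, whatever the underlying σ-algebra:
the state at time `t` uses only the dither before time `t`. -/
lemma measurable_dithered_recursion [MeasurableSpace Ω] {x w : ℕ → Ω → Vec (Fin n ⊕ Fin m)}
    {u : ℕ → Ω → Vec (Fin p)} {d ztil y xtil xhat : ℕ → Ω → Vec (Fin n)}
    (plant : ∀ t ω, x (t + 1) ω = act S.A (x t ω) + act S.B (u t ω) + w t ω)
    (prior : ∀ t, ∃ g : ((Fin t → Vec (Fin n)) × (Fin (t + 1) → Vec (Fin m))) →ᵃ[ℝ] Vec (Fin n),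
      ∀ ω, xtil t ω = g (observed y x t (t + 1) ω))
    (quantizer : ∀ t ω, ztil t ω = quantize sens (act S.C₁ (fstBlock (x t ω) - xtil t ω) + d t ω))
    (decoder : ∀ t ω, y t ω = ztil t ω - d t ω)
    (posterior : ∀ t,
      ∃ g : ((Fin (t + 1) → Vec (Fin n)) × (Fin (t + 1) → Vec (Fin m))) →ᵃ[ℝ] Vec (Fin n),
      ∀ ω, xhat t ω = g (observed y x (t + 1) (t + 1) ω))
    (control : ∀ t ω, u t ω = act S.K (stack (xhat t ω) (sndBlock (x t ω))))
    (hx : Measurable (x 0)) (hw : ∀ t, Measurable (w t)) (t : ℕ)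
    (hd : ∀ s < t, Measurable (d s)) :
    (∀ j ≤ t, Measurable (x j)) ∧ (∀ j ≤ t, Measurable (xtil j)) ∧ ∀ j < t, Measurable (y j) := by
  have hxtil : ∀ t, (∀ j ≤ t, Measurable (x j)) → (∀ j < t, Measurable (y j)) →
      Measurable (xtil t) := by
    intro t h1 h2
    obtain ⟨g, hg⟩ := prior t
    rw [show xtil t = _ from funext hg]
    exact (measurable_affineMap g).comp
      (measurable_observed h2 fun k hk => h1 k (Nat.lt_succ_iff.1 hk))
  induction t with
  | zero =>
    have h1 : ∀ j ≤ 0, Measurable (x j) := fun j hj => by rwa [Nat.le_zero.1 hj]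
    have h2 : ∀ j < 0, Measurable (y j) := fun j hj => absurd hj (Nat.not_lt_zero _)
    exact ⟨h1, fun j hj => by rw [Nat.le_zero.1 hj]; exact hxtil 0 h1 h2, h2⟩
  | succ t ih =>
    obtain ⟨h1, h2, h3⟩ := ih fun s hs => hd s (hs.trans (Nat.lt_succ_self t))
    have hz : Measurable (ztil t) := by
      rw [show ztil t = _ from funext (quantizer t)]
      have hin : Measurable fun ω => act S.C₁ (fstBlock (x t ω) - xtil t ω) + d t ω :=
        (measurable_act_fstBlock_sub (h1 t le_rfl) (h2 t le_rfl)).add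
          (hd t (Nat.lt_succ_self t))
      rw [measurable_vec_iff] at hin ⊢
      intro i
      have hfl : Measurable fun r : ℝ => ((⌊r / sens + 1 / 2⌋ : ℤ) : ℝ) * sens := by
        have := (measurable_quantError sens).add measurable_id
        convert this using 1
        ext r
        simp [quantError]
      exact hfl.comp (hin i)
    have h3' : ∀ j < t + 1, Measurable (y j) := by
      intro j hj
      rcases Nat.lt_succ_iff_lt_or_eq.1 hj with hj | rfl
      · exact h3 j hj
      · rw [show y j = _ from funext (decoder j)]
        exact hz.sub (hd j (Nat.lt_succ_self j))
    have h1' : ∀ j ≤ t + 1, Measurable (x j) := by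
      intro j hj
      rcases Nat.le_succ_iff.1 hj with hj | rfl
      · exact h1 j hj
      · obtain ⟨g, hg⟩ := posterior t
        have hxh : Measurable (xhat t) := by
          rw [show xhat t = _ from funext hg]
          exact (measurable_affineMap g).comp
            (measurable_observed h3' fun k hk => h1 k (Nat.lt_succ_iff.1 hk))
        have hu : Measurable (u t) := by
          rw [show u t = _ from funext (control t)]
          exact measurable_act (measurable_stack hxh (measurable_sndBlock (h1 t le_rfl)))
        rw [show x (t + 1) = _ from funext (plant t)]
        exact ((measurable_act (h1 t le_rfl)).add (measurable_act hu)).add (hw t)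
    refine ⟨h1', fun j hj => ?_, h3'⟩
    rcases Nat.le_succ_iff.1 hj with hj | rfl
    · exact h2 j hj
    · exact hxtil _ h1' h3'

/-! ### The quantization noise -/

variable [MeasurableSpace Ω] {P : Measure Ω}

/-- The quantizer input before dithering. -/
def DitheredLoop.input (N : DitheredLoop S P) (t : ℕ) (ω : Ω) : Vec (Fin n) :=
  act S.C₁ (fstBlock (N.x t ω) - N.xtil t ω)

/-- The error of the dithered quantizer, which plays the part of the sensor noise `v`. -/
noncomputable def DitheredLoop.noise (N : DitheredLoop S P) (t : ℕ) (ω : Ω) : Vec (Fin n) :=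
  WithLp.toLp 2 fun i => quantError sens (N.input t ω i + N.d t ω i)

/-- The decoder output is the quantizer input plus the quantization noise: the dither cancels. -/
lemma DitheredLoop.y_eq (N : DitheredLoop S P) (t : ℕ) (ω : Ω) :
    N.y t ω = N.input t ω + N.noise t ω := by
  ext i
  rw [N.decoder, N.quantizer]
  simp [DitheredLoop.input, DitheredLoop.noise, quantize, quantError]
  ring

/-- The state and the quantizer input at time `t` are measurable for every σ-algebra `m₀` that makes
the initial state, the plant noise and the dither before time `t` measurable. -/
lemma DitheredLoop.measurable_of_le {Ω : Type*} {m₀ : MeasurableSpace Ω} [MeasurableSpace Ω]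
    {P : Measure Ω} (N : DitheredLoop S P) (hx : Measurable[m₀] (N.x 0))
    (hw : ∀ t, Measurable[m₀] (N.w t)) {t : ℕ} (hd : ∀ s < t, Measurable[m₀] (N.d s)) :
    Measurable[m₀] (N.x t) ∧ Measurable[m₀] (N.input t) := by
  have h := @measurable_dithered_recursion n m p S Ω m₀ N.x N.w N.u N.d N.ztil N.y N.xtil N.xhat
    N.plant (fun t => (N.prior t).1) N.quantizer N.decoder (fun t => (N.posterior t).1) N.control
    hx hw t hd
  exact ⟨h.1 t le_rfl, @measurable_act_fstBlock_sub n m Ω m₀ _ _ _ (h.1 t le_rfl)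
    (h.2.1 t le_rfl)⟩

lemma DitheredLoop.measurable_input (N : DitheredLoop S P) (t : ℕ) : Measurable (N.input t) :=
  (N.measurable_of_le N.measurable_x_zero N.measurable_w fun s _ => N.measurable_d s).2

lemma DitheredLoop.measurable_noise (N : DitheredLoop S P) (t : ℕ) : Measurable (N.noise t) := by
  rw [measurable_vec_iff]
  exact fun i => (measurable_quantError sens).comp
    ((measurable_vec_iff.1 (N.measurable_input t) i).add
      (measurable_vec_iff.1 (N.measurable_d t) i))

lemma DitheredLoop.measurable_ztil (N : DitheredLoop S P) (t : ℕ) : Measurable (N.ztil t) := by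
  have h : N.ztil t = fun ω => N.input t ω + N.noise t ω + N.d t ω := by
    ext1 ω
    rw [← N.y_eq, N.decoder, sub_add_cancel]
  rw [h]
  exact ((N.measurable_input t).add (N.measurable_noise t)).add (N.measurable_d t)

/-- All the randomness of the dithered loop except one entry of the dither. -/
def DitheredLoop.others (N : DitheredLoop S P) (ti : ℕ × Fin n) (ω : Ω) :
    (Vec (Fin n ⊕ Fin m) × (ℕ → Vec (Fin n ⊕ Fin m))) × ({k : ℕ × Fin n // k ≠ ti} → ℝ) :=
  ((N.x 0 ω, fun t => N.w t ω), fun k => N.d k.1.1 ω k.1.2)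

lemma DitheredLoop.indepFun_others [IsProbabilityMeasure P] (N : DitheredLoop S P)
    (ti : ℕ × Fin n) : IndepFun (fun ω => N.d ti.1 ω ti.2) (N.others ti) P := by
  have hdm : ∀ k : ℕ × Fin n, Measurable fun ω => N.d k.1 ω k.2 := fun k =>
    measurable_vec_iff.1 (N.measurable_d k.1) k.2
  refine indepFun_prodMk_of_indepFun (a := fun ω => (N.x 0 ω, fun t => N.w t ω))
    (c := fun ω (k : {k : ℕ × Fin n // k ≠ ti}) => N.d k.1.1 ω k.1.2)
    (N.measurable_x_zero.prodMk (measurable_pi_lambda _ N.measurable_w)) (hdm ti)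
    (measurable_pi_lambda _ fun k => hdm k.1) ?_ ?_
  · have hψ : Measurable fun D : ℕ → Vec (Fin n) =>
        (D ti.1 ti.2, fun k : {k : ℕ × Fin n // k ≠ ti} => D k.1.1 k.1.2) := by
      have h : ∀ k : ℕ × Fin n, Measurable fun D : ℕ → Vec (Fin n) => D k.1 k.2 := fun k =>
        measurable_vec_iff.1 (measurable_pi_apply k.1) k.2
      exact (h ti).prodMk (measurable_pi_lambda _ fun k => h k.1)
    exact N.indep_x_zero_w_d.comp measurable_id hψ
  · have h := indep_iSup_of_disjoint (fun k => (hdm k).comap_le) N.indep_d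
      (S := {ti}) (T := {k | k ≠ ti}) (by simp)
    refine indep_of_indep_of_le_left (indep_of_indep_of_le_right h ?_) ?_
    · refine measurable_iff_comap_le.1 (@measurable_pi_lambda _ _ _ (_) _ _ fun k => ?_)
      exact measurable_iff_comap_le.2 (le_iSup₂_of_le k.1 k.2 le_rfl)
    · exact le_iSup₂_of_le ti rfl le_rfl

/-- The quantizer input at time `t` does not involve the dither at time `t`. -/
lemma DitheredLoop.measurable_input_others (N : DitheredLoop S P) (t : ℕ) (i : Fin n) :
    Measurable[MeasurableSpace.comap (N.others (t, i)) inferInstance] (N.input t) := by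
  have hc : Measurable[MeasurableSpace.comap (N.others (t, i)) inferInstance] (N.others (t, i)) :=
    comap_measurable _
  refine (N.measurable_of_le (measurable_fst.comp (measurable_fst.comp hc)) (fun s =>
    (measurable_pi_apply s).comp (measurable_snd.comp (measurable_fst.comp hc)))
    fun s hs => measurable_vec_iff.2 fun j => ?_).2
  have hne : (s, j) ≠ (t, i) := fun h => hs.ne (congrArg Prod.fst h)
  exact (measurable_pi_apply (⟨(s, j), hne⟩ : {k : ℕ × Fin n // k ≠ (t, i)})).comp
    (measurable_snd.comp hc)

/-- Entries of the quantization noise up to time `t`, other than the entry `(t, i)`, do not involve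
the dither entry `(t, i)`. -/
lemma DitheredLoop.measurable_noise_others (N : DitheredLoop S P) {s t : ℕ} {i j : Fin n}
    (hst : s ≤ t) (hne : (s, j) ≠ (t, i)) :
    Measurable[MeasurableSpace.comap (N.others (t, i)) inferInstance]
      (fun ω => N.noise s ω j) := by
  have hc : Measurable[MeasurableSpace.comap (N.others (t, i)) inferInstance] (N.others (t, i)) :=
    comap_measurable _
  have hd : ∀ k (hk : k ≠ (t, i)),
      Measurable[MeasurableSpace.comap (N.others (t, i)) inferInstance]
        (fun ω => N.d k.1 ω k.2) := fun k hk =>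
    (measurable_pi_apply (⟨k, hk⟩ : {k : ℕ × Fin n // k ≠ (t, i)})).comp (measurable_snd.comp hc)
  have hin := (N.measurable_of_le (t := s) (measurable_fst.comp (measurable_fst.comp hc)) (fun s =>
    (measurable_pi_apply s).comp (measurable_snd.comp (measurable_fst.comp hc)))
    fun r hr => measurable_vec_iff.2 fun l => hd (r, l) fun h =>
      (hr.trans_le hst).ne (congrArg Prod.fst h)).2
  exact (measurable_quantError sens).comp ((measurable_vec_iff.1 hin j).add (hd (s, j) hne))

end

/-! ### Second moments of the driving noises -/

section
variable {Ω : Type*} [MeasurableSpace Ω] {P : Measure Ω} {κ : Type} [Fintype κ]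

lemma _root_.ProbabilityTheory.HasGaussianLaw.coord {X : Ω → Vec κ} (hX : HasGaussianLaw X P)
    (i : κ) : HasGaussianLaw (fun ω => X ω i) P :=
  hX.map_fun (EuclideanSpace.proj (𝕜 := ℝ) i : Vec κ →L[ℝ] ℝ)

variable [DecidableEq κ] {W : Matrix κ κ ℝ}

lemma integral_coord_multivariateGaussian {X : Ω → Vec κ}
    (hX : HasLaw X (multivariateGaussian 0 W) P) (i : κ) : ∫ ω, X ω i ∂P = 0 := by
  have h := hX.integral_comp (f := fun z : Vec κ => z i) (by fun_prop)
  have h2 : ∫ z : Vec κ, z i ∂(multivariateGaussian 0 W) = 0 := by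
    have := ContinuousLinearMap.integral_comp_comm
      (EuclideanSpace.proj (𝕜 := ℝ) i : Vec κ →L[ℝ] ℝ)
      (IsGaussian.integrable_id (μ := multivariateGaussian (0 : Vec κ) W))
    simpa using this
  exact h.trans h2

lemma integral_noise_mul_of_indepFun {w : ℕ → Ω → Vec κ}
    (hw : ∀ t, HasLaw (w t) (multivariateGaussian 0 W) P) {F : Ω → ℝ}
    (hF : AEStronglyMeasurable F P) (hind : IndepFun F (fun ω t => w t ω) P) (t : ℕ) (i : κ) :
    ∫ ω, F ω * w t ω i ∂P = 0 := by
  have h : IndepFun F (fun ω => w t ω i) P :=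
    hind.comp (φ := id) (ψ := fun z : ℕ → Vec κ => z t i) measurable_id
      (measurable_vec_iff.1 (measurable_pi_apply t) i)
  have h2 := h.integral_mul_eq_mul_integral hF
    ((hw t).hasGaussianLaw.coord i).aemeasurable.aestronglyMeasurable
  rw [integral_coord_multivariateGaussian (hw t), mul_zero] at h2
  exact h2

lemma integral_noise_mul_noise {w : ℕ → Ω → Vec κ}
    (hw : ∀ t, HasLaw (w t) (multivariateGaussian 0 W) P) (hind : iIndepFun w P) (t s : ℕ)
    (i j : κ) : ∫ ω, w t ω i * w s ω j ∂P =
      if t = s then ∫ z : Vec κ, z i * z j ∂(multivariateGaussian 0 W) else 0 := by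
  split_ifs with h
  · subst h
    exact (hw t).integral_comp (f := fun z : Vec κ => z i * z j) (by fun_prop)
  · have h1 : IndepFun (fun ω => w t ω i) (fun ω => w s ω j) P :=
      (hind.indepFun h).comp (φ := fun z : Vec κ => z i) (ψ := fun z : Vec κ => z j)
        (by fun_prop) (by fun_prop)
    have h2 := h1.integral_mul_eq_mul_integral
      ((hw t).hasGaussianLaw.coord i).aemeasurable.aestronglyMeasurable
      ((hw s).hasGaussianLaw.coord j).aemeasurable.aestronglyMeasurable
    rw [integral_coord_multivariateGaussian (hw t), zero_mul] at h2
    exact h2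

end

section
variable {n m p : ℕ} {S : System n m p} {Ω : Type*} [MeasurableSpace Ω] {P : Measure Ω}
  [IsProbabilityMeasure P]

/-- The quantization noise entry `(t, i)` is orthogonal to everything that does not involve the
dither entry `(t, i)`. -/
lemma DitheredLoop.integral_noise_mul (N : DitheredLoop S P) (t : ℕ) (i : Fin n) {F : Ω → ℝ}
    (hF : Measurable[MeasurableSpace.comap (N.others (t, i)) inferInstance] F)
    (hFm : Measurable F) (hFi : Integrable F P) : ∫ ω, N.noise t ω i * F ω ∂P = 0 := by
  have hind : IndepFun (fun ω => N.d t ω i) (fun ω => (N.input t ω i, F ω)) P := by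
    refine indepFun_of_measurable_comap (N.indepFun_others (t, i)) (comap_measurable _) ?_
    exact (measurable_vec_iff.1 (N.measurable_input_others t i) i).prodMk hF
  exact integral_quantError_mul sens_pos (measurable_vec_iff.1 (N.measurable_input t) i) hFm
    (measurable_vec_iff.1 (N.measurable_d t) i) (N.law_d t i) hind hFi

lemma DitheredLoop.memLp_noise (N : DitheredLoop S P) (t : ℕ) (i : Fin n) :
    MemLp (fun ω => N.noise t ω i) 2 P :=
  MemLp.of_bound (measurable_vec_iff.1 (N.measurable_noise t) i).aestronglyMeasurable (sens / 2)
    (ae_of_all _ fun _ => abs_quantError_le sens_pos _)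

/-- The quantization noise is orthogonal to the initial state and the plant noise of all times,
future ones included. -/
lemma DitheredLoop.integral_noise_mul_base (N : DitheredLoop S P) (t : ℕ) (i : Fin n)
    (φ : (Vec (Fin n ⊕ Fin m) × (ℕ → Vec (Fin n ⊕ Fin m))) → ℝ) (hφ : Measurable φ)
    (hi : Integrable (fun ω => φ (N.x 0 ω, fun t => N.w t ω)) P) :
    ∫ ω, N.noise t ω i * φ (N.x 0 ω, fun t => N.w t ω) ∂P = 0 := by
  have hc : Measurable[MeasurableSpace.comap (N.others (t, i)) inferInstance] (N.others (t, i)) :=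
    comap_measurable _
  exact N.integral_noise_mul t i (hφ.comp (measurable_fst.comp hc))
    (hφ.comp (N.measurable_x_zero.prodMk (measurable_pi_lambda _ N.measurable_w))) hi

/-- The quantization noise at time `t` is orthogonal to the quantizer input at time `t`. -/
lemma DitheredLoop.integral_noise_mul_input (N : DitheredLoop S P) (t : ℕ) (i j : Fin n)
    (hi : Integrable (fun ω => N.input t ω j) P) :
    ∫ ω, N.noise t ω i * N.input t ω j ∂P = 0 :=
  N.integral_noise_mul t i (measurable_vec_iff.1 (N.measurable_input_others t i) j)
    (measurable_vec_iff.1 (N.measurable_input t) j) hi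

/-- The quantization noise is white with unit variance, as is the Gaussian sensor noise; this is
where `Δ² = 12` matters. -/
lemma DitheredLoop.integral_noise_mul_noise (N : DitheredLoop S P) (t s : ℕ) (i j : Fin n) :
    ∫ ω, N.noise t ω i * N.noise s ω j ∂P = if t = s then if i = j then 1 else 0 else 0 := by
  have key : ∀ (t s : ℕ) (i j : Fin n), s ≤ t → (s, j) ≠ (t, i) →
      ∫ ω, N.noise t ω i * N.noise s ω j ∂P = 0 := fun t s i j hst hne =>
    N.integral_noise_mul t i (N.measurable_noise_others hst hne)
      (measurable_vec_iff.1 (N.measurable_noise s) j)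
      ((N.memLp_noise s j).integrable one_le_two)
  by_cases h : (s, j) = (t, i)
  · obtain ⟨rfl, rfl⟩ := Prod.mk.inj h
    simp only [if_true]
    have hind : IndepFun (fun ω => N.d s ω j) (fun ω => N.input s ω j) P :=
      indepFun_of_measurable_comap (N.indepFun_others (s, j)) (comap_measurable _)
        (measurable_vec_iff.1 (N.measurable_input_others s j) j)
    have h2 := integral_quantError_sq sens_pos (measurable_vec_iff.1 (N.measurable_input s) j)
      (measurable_vec_iff.1 (N.measurable_d s) j) (N.law_d s j) hind
    rw [sens_sq, div_self (by norm_num)] at h2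
    exact h2
  · have h0 : ∫ ω, N.noise t ω i * N.noise s ω j ∂P = 0 := by
      rcases le_total s t with hst | hst
      · exact key t s i j hst h
      · rw [← key s t j i hst fun h2 => h h2.symm]
        simp only [mul_comm]
    rw [h0]
    split_ifs with h1 h2
    · subst h1 h2; exact absurd rfl h
    · rfl
    · rfl

end

/-! ### Coupling the two loops -/

section
variable {n m p : ℕ} {S : System n m p} {Ω : Type*} [MeasurableSpace Ω] {P : Measure Ω}
  {Ω' : Type*} [MeasurableSpace Ω'] {P' : Measure Ω'}

/-- Pairs formed by the constants, the entries of the initial states and the entries of the plant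
noises. -/
def plantPairs (G : GaussianLoop S P) (N : DitheredLoop S P') : Set ((Ω → ℝ) × (Ω' → ℝ)) :=
  {(1, 1)} ∪ Set.range (fun i => (fun ω => G.x 0 ω i, fun ω => N.x 0 ω i)) ∪
    Set.range (fun ti : ℕ × (Fin n ⊕ Fin m) =>
      (fun ω => G.w ti.1 ω ti.2, fun ω => N.w ti.1 ω ti.2))

/-- Pairs formed by the entries of the sensor noise and of the quantization noise. -/
def sensorPairs (G : GaussianLoop S P) (N : DitheredLoop S P') : Set ((Ω → ℝ) × (Ω' → ℝ)) :=
  Set.range (fun ti : ℕ × Fin n => (fun ω => G.v ti.1 ω ti.2, fun ω => N.noise ti.1 ω ti.2))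

/-- The coupled space of the two loops, spanned by the driving randomness of both. -/
def loopSpace (G : GaussianLoop S P) (N : DitheredLoop S P') :
    Submodule ℝ ((Ω → ℝ) × (Ω' → ℝ)) :=
  Submodule.span ℝ (plantPairs G N ∪ sensorPairs G N ∪ {q | q.1 =ᵐ[P] 0 ∧ q.2 = 0})

variable {G : GaussianLoop S P} {N : DitheredLoop S P'}

lemma integral_mul_eq_of_mem_sensorPairs [IsProbabilityMeasure P']
    {q r : (Ω → ℝ) × (Ω' → ℝ)} (hq : q ∈ sensorPairs G N) (hr : r ∈ sensorPairs G N) :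
    ∫ ω, q.1 ω * r.1 ω ∂P = ∫ ω, q.2 ω * r.2 ω ∂P' := by
  obtain ⟨⟨t, i⟩, rfl⟩ := hq
  obtain ⟨⟨s, j⟩, rfl⟩ := hr
  simp only [integral_noise_mul_noise G.law_v G.indep_v, N.integral_noise_mul_noise]
  rw [multivariateGaussian_zero_one, integral_coord_mul_coord_stdGaussian]

/-- First components of the coupled space are Gaussian. -/
lemma hasGaussianLaw_of_mem_loopSpace {q : (Ω → ℝ) × (Ω' → ℝ)} (hq : q ∈ loopSpace G N) :
    HasGaussianLaw q.1 P := by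
  have key : ∃ f ∈ Submodule.span ℝ (Set.range fun i ω => G.x 0 ω i),
      ∃ g ∈ Submodule.span ℝ (Set.range fun (ti : ℕ × (Fin n ⊕ Fin m)) ω => G.w ti.1 ω ti.2),
      ∃ h ∈ Submodule.span ℝ (Set.range fun (ti : ℕ × Fin n) ω => G.v ti.1 ω ti.2),
      ∃ c : ℝ, q.1 =ᵐ[P] fun ω => (f + g + h) ω + c := by
    induction hq using Submodule.span_induction with
    | mem q hq =>
      rcases hq with (((rfl | ⟨i, rfl⟩) | ⟨ti, rfl⟩) | ⟨ti, rfl⟩) | ⟨hq, -⟩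
      · exact ⟨0, zero_mem _, 0, zero_mem _, 0, zero_mem _, 1, ae_of_all _ fun ω => by simp⟩
      · exact ⟨_, Submodule.subset_span ⟨i, rfl⟩, 0, zero_mem _, 0, zero_mem _, 0,
          ae_of_all _ fun ω => by simp⟩
      · exact ⟨0, zero_mem _, _, Submodule.subset_span ⟨ti, rfl⟩, 0, zero_mem _, 0,
          ae_of_all _ fun ω => by simp⟩
      · exact ⟨0, zero_mem _, 0, zero_mem _, _, Submodule.subset_span ⟨ti, rfl⟩, 0,
          ae_of_all _ fun ω => by simp⟩
      · refine ⟨0, zero_mem _, 0, zero_mem _, 0, zero_mem _, 0, ?_⟩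
        filter_upwards [hq] with ω hω
        simp [hω]
    | zero => exact ⟨0, zero_mem _, 0, zero_mem _, 0, zero_mem _, 0, ae_of_all _ fun ω => by simp⟩
    | add q r _ _ hq hr =>
      obtain ⟨f, hf, g, hg, h, hh, c, hc⟩ := hq
      obtain ⟨f', hf', g', hg', h', hh', c', hc'⟩ := hr
      refine ⟨f + f', add_mem hf hf', g + g', add_mem hg hg', h + h', add_mem hh hh', c + c', ?_⟩
      filter_upwards [hc, hc'] with ω h1 h2
      simp only [Prod.fst_add, Pi.add_apply] at h1 h2 ⊢
      rw [h1, h2]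
      ring
    | smul a q _ hq =>
      obtain ⟨f, hf, g, hg, h, hh, c, hc⟩ := hq
      refine ⟨a • f, Submodule.smul_mem _ a hf, a • g, Submodule.smul_mem _ a hg, a • h,
        Submodule.smul_mem _ a hh, a * c, ?_⟩
      filter_upwards [hc] with ω h1
      simp only [Prod.smul_fst, Pi.smul_apply, Pi.add_apply, smul_eq_mul] at h1 ⊢
      rw [h1]
      ring
  obtain ⟨f, hf, g, hg, h, hh, c, hc⟩ := key
  exact ((hasGaussianLaw_of_mem_span_sum G.gaussian_x_zero (fun t => (G.law_w t).hasGaussianLaw)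
    (fun t => (G.law_v t).hasGaussianLaw) G.indep_w G.indep_v G.indep_x_zero_w G.indep_x_zero_w_v
    hf hg hh).add_const c).congr hc.symm

variable [IsProbabilityMeasure P] [IsProbabilityMeasure P']

lemma memLp_of_mem_plantPairs {q : (Ω → ℝ) × (Ω' → ℝ)} (hq : q ∈ plantPairs G N) :
    MemLp q.1 2 P ∧ MemLp q.2 2 P' := by
  rcases hq with (rfl | ⟨i, rfl⟩) | ⟨⟨t, i⟩, rfl⟩
  · exact ⟨memLp_const 1, memLp_const 1⟩
  · exact ⟨(G.gaussian_x_zero.coord i).memLp_two, N.memLp_x_zero.eval_piLp i⟩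
  · exact ⟨((G.law_w t).hasGaussianLaw.coord i).memLp_two,
      ((N.law_w t).hasGaussianLaw.coord i).memLp_two⟩

lemma integral_mul_eq_of_mem_plantPairs
    (first_moments : ∀ i, ∫ ω, N.x 0 ω i ∂P' = ∫ ω, G.x 0 ω i ∂P)
    (second_moments : ∀ i j,
      ∫ ω, N.x 0 ω i * N.x 0 ω j ∂P' = ∫ ω, G.x 0 ω i * G.x 0 ω j ∂P)
    {q r : (Ω → ℝ) × (Ω' → ℝ)} (hq : q ∈ plantPairs G N) (hr : r ∈ plantPairs G N) :
    ∫ ω, q.1 ω * r.1 ω ∂P = ∫ ω, q.2 ω * r.2 ω ∂P' := by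
  have hxG : ∀ i t j, ∫ ω, G.x 0 ω i * G.w t ω j ∂P = 0 := fun i t j =>
    integral_noise_mul_of_indepFun G.law_w
      (G.gaussian_x_zero.coord i).aemeasurable.aestronglyMeasurable
      (G.indep_x_zero_w.comp (φ := fun z : Vec (Fin n ⊕ Fin m) => z i) (ψ := id) (by fun_prop)
        measurable_id) t j
  have hxN : ∀ i t j, ∫ ω, N.x 0 ω i * N.w t ω j ∂P' = 0 := fun i t j =>
    integral_noise_mul_of_indepFun N.law_w (N.memLp_x_zero.eval_piLp i).aestronglyMeasurable
      (N.indep_x_zero_w.comp (φ := fun z : Vec (Fin n ⊕ Fin m) => z i) (ψ := id) (by fun_prop)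
        measurable_id) t j
  have hwG := fun t i => integral_coord_multivariateGaussian (G.law_w t) i
  have hwN := fun t i => integral_coord_multivariateGaussian (N.law_w t) i
  rcases hq with (rfl | ⟨i, rfl⟩) | ⟨⟨t, i⟩, rfl⟩ <;>
    rcases hr with (rfl | ⟨j, rfl⟩) | ⟨⟨s, j⟩, rfl⟩ <;>
    simp only [Pi.one_apply, one_mul, mul_one, first_moments, second_moments, hxG, hxN, hwG, hwN,
      integral_noise_mul_noise G.law_w G.indep_w, integral_noise_mul_noise N.law_w N.indep_w,
      mul_comm (G.w _ _ _) (G.x _ _ _), mul_comm (N.w _ _ _) (N.x _ _ _)]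
  simp

lemma integral_mul_eq_zero_of_mem_plantPairs {q : (Ω → ℝ) × (Ω' → ℝ)}
    (hq : q ∈ plantPairs G N) (t : ℕ) (i : Fin n) :
    ∫ ω, q.1 ω * G.v t ω i ∂P = 0 ∧ ∫ ω, q.2 ω * N.noise t ω i ∂P' = 0 := by
  have hqG : ∃ φ : (Vec (Fin n ⊕ Fin m) × (ℕ → Vec (Fin n ⊕ Fin m))) → ℝ, Measurable φ ∧
      q.1 = (fun ω => φ (G.x 0 ω, fun t => G.w t ω)) ∧
      q.2 = fun ω => φ (N.x 0 ω, fun t => N.w t ω) := by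
    rcases hq with (rfl | ⟨j, rfl⟩) | ⟨⟨s, j⟩, rfl⟩
    · exact ⟨fun _ => 1, measurable_const, rfl, rfl⟩
    · exact ⟨fun z => z.1 j, measurable_vec_iff.1 measurable_fst j, rfl, rfl⟩
    · exact ⟨fun z => z.2 s j,
        measurable_vec_iff.1 ((measurable_pi_apply s).comp measurable_snd) j, rfl, rfl⟩
  obtain ⟨h1, h2⟩ := memLp_of_mem_plantPairs hq
  obtain ⟨φ, hφ, e1, e2⟩ := hqG
  rw [e1] at h1 ⊢
  rw [e2] at h2 ⊢
  constructor
  · exact integral_noise_mul_of_indepFun G.law_v h1.aestronglyMeasurable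
      (G.indep_x_zero_w_v.comp hφ measurable_id) t i
  · have := N.integral_noise_mul_base t i φ hφ (h2.integrable one_le_two)
    simpa only [mul_comm] using this

lemma isCoupledSpace_loopSpace
    (first_moments : ∀ i, ∫ ω, N.x 0 ω i ∂P' = ∫ ω, G.x 0 ω i ∂P)
    (second_moments : ∀ i j,
      ∫ ω, N.x 0 ω i * N.x 0 ω j ∂P' = ∫ ω, G.x 0 ω i * G.x 0 ω j ∂P) :
    IsCoupledSpace P P' (loopSpace G N) := by
  have hmem : ∀ q ∈ plantPairs G N ∪ sensorPairs G N ∪ {q | q.1 =ᵐ[P] 0 ∧ q.2 = 0},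
      MemLp q.1 2 P ∧ MemLp q.2 2 P' := by
    rintro q ((hq | ⟨⟨t, i⟩, rfl⟩) | ⟨h1, h2⟩)
    · exact memLp_of_mem_plantPairs hq
    · exact ⟨((G.law_v t).hasGaussianLaw.coord i).memLp_two, N.memLp_noise t i⟩
    · exact ⟨(memLp_congr_ae h1).2 MemLp.zero, h2 ▸ MemLp.zero⟩
  have hnull : ∀ q r : (Ω → ℝ) × (Ω' → ℝ), q.1 =ᵐ[P] 0 → q.2 = 0 →
      ∫ ω, q.1 ω * r.1 ω ∂P = ∫ ω, q.2 ω * r.2 ω ∂P' := by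
    intro q r h1 h2
    have h3 : (fun ω => q.1 ω * r.1 ω) =ᵐ[P] 0 := by
      filter_upwards [h1] with ω hω
      simp [hω]
    rw [integral_congr_ae h3, h2]
    simp
  have hps : ∀ q ∈ plantPairs G N, ∀ r ∈ sensorPairs G N,
      ∫ ω, q.1 ω * r.1 ω ∂P = ∫ ω, q.2 ω * r.2 ω ∂P' := by
    rintro q hq r ⟨⟨t, i⟩, rfl⟩
    obtain ⟨h1, h2⟩ := integral_mul_eq_zero_of_mem_plantPairs hq t i
    exact h1.trans h2.symm
  refine ⟨fun q hq => hasGaussianLaw_of_mem_loopSpace hq,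
    fun q hq => (memLp_pair_of_mem_span hmem hq).2,
    fun q hq r hr => integral_mul_eq_of_mem_span hmem ?_ hq hr,
    Submodule.subset_span (Or.inl (Or.inl (Or.inl (Or.inl rfl)))),
    fun f hf => Submodule.subset_span (Or.inr ⟨hf, rfl⟩)⟩
  rintro q ((hq | hq) | ⟨h1, h2⟩) r ((hr | hr) | ⟨h3, h4⟩)
  · exact integral_mul_eq_of_mem_plantPairs first_moments second_moments hq hr
  · exact hps q hq r hr
  · simpa only [mul_comm] using hnull r q h3 h4
  · simpa only [mul_comm] using hps r hr q hq
  · exact integral_mul_eq_of_mem_sensorPairs hq hr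
  · simpa only [mul_comm] using hnull r q h3 h4
  all_goals exact hnull q _ h1 h2

/-- The two loops are coupled at all times. The measurement of the dithered loop enters through
`y + C₁ xtil`, which is `C₁ x¹` plus quantization noise. -/
lemma coupled_loops (hV : IsCoupledSpace P P' (loopSpace G N)) (t : ℕ) :
    Coupled (loopSpace G N) (G.x t) (N.x t) ∧ Coupled (loopSpace G N) (G.xtil t) (N.xtil t) ∧
      Coupled (loopSpace G N) (G.y t) (fun ω => N.y t ω + act S.C₁ (N.xtil t ω)) := by
  have hw : ∀ t, Coupled (loopSpace G N) (G.w t) (N.w t) := fun t i =>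
    Submodule.subset_span (Or.inl (Or.inl (Or.inr ⟨(t, i), rfl⟩)))
  have hv : ∀ t, Coupled (loopSpace G N) (G.v t) (N.noise t) := fun t i =>
    Submodule.subset_span (Or.inl (Or.inr ⟨(t, i), rfl⟩))
  have hx0 : Coupled (loopSpace G N) (G.x 0) (N.x 0) := fun i =>
    Submodule.subset_span (Or.inl (Or.inl (Or.inl (Or.inr ⟨i, rfl⟩))))
  let y'' : ℕ → Ω' → Vec (Fin n) := fun t ω => N.y t ω + act S.C₁ (N.xtil t ω)
  have hspan : ∀ s t, s ≤ t → obsSpan y'' N.x s t = obsSpan N.y N.x s t := by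
    intro s t hst
    refine obsSpan_eq_of_shift (e := fun t ω => act S.C₁ (N.xtil t ω)) (fun _ _ => rfl)
      (fun k i => ?_) hst
    obtain ⟨g, hg⟩ := (N.prior k).1
    have h : (fun ω => act S.C₁ (N.xtil k ω) i) =
        ∑ j, S.C₁ i j • fun ω => N.xtil k ω j := by
      ext ω
      simp [act_apply, Finset.sum_apply]
    rw [h]
    refine Submodule.sum_mem _ fun j _ => Submodule.smul_mem _ _ ?_
    have h2 := affine_comp_observed_mem_obsSpan (y := N.y) (x := N.x)
      ((EuclideanSpace.proj (𝕜 := ℝ) j : Vec (Fin n) →L[ℝ] ℝ).toLinearMap.toAffineMap.comp g)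
    convert h2 using 2 with ω
    rw [hg]
    rfl
  have hxtil : ∀ t, (∀ k ≤ t, Coupled (loopSpace G N) (G.x k) (N.x k)) →
      (∀ k < t, Coupled (loopSpace G N) (G.y k) (y'' k)) →
      Coupled (loopSpace G N) (G.xtil t) (N.xtil t) := fun t hx hy =>
    hV.coupled_estimate (fun k _ => G.measurable_y k) (fun k _ => G.measurable_x k) hy
      (fun k hk => hx k (Nat.lt_succ_iff.1 hk)) (hspan _ _ (Nat.le_succ t)) (hx t le_rfl).fstBlock
      (G.prior t) (N.prior t)
  have hyy : ∀ t, Coupled (loopSpace G N) (G.x t) (N.x t) →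
      Coupled (loopSpace G N) (G.y t) (y'' t) := by
    intro t hx
    have h := (hx.fstBlock.act S.C₁).add (hv t)
    have e1 : G.y t = fun ω => act S.C₁ (fstBlock (G.x t ω)) + G.v t ω := funext (G.sensor t)
    have e2 : y'' t = fun ω => act S.C₁ (fstBlock (N.x t ω)) + N.noise t ω := by
      ext1 ω
      simp only [y'', N.y_eq, DitheredLoop.input, act_sub]
      abel
    rw [e1, e2]
    exact h
  have hall : ∀ t, ∀ k ≤ t, Coupled (loopSpace G N) (G.x k) (N.x k) := by
    intro t
    induction t with
    | zero => intro k hk; rw [Nat.le_zero.1 hk]; exact hx0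
    | succ t ih =>
      intro k hk
      rcases Nat.le_succ_iff.1 hk with hk | rfl
      · exact ih k hk
      · have hxhat : Coupled (loopSpace G N) (G.xhat t) (N.xhat t) :=
          hV.coupled_estimate (fun k _ => G.measurable_y k) (fun k _ => G.measurable_x k)
            (fun k hk => hyy k (ih k (Nat.lt_succ_iff.1 hk)))
            (fun k hk => ih k (Nat.lt_succ_iff.1 hk)) (hspan _ _ le_rfl) (ih t le_rfl).fstBlock
            (G.posterior t) (N.posterior t)
        have hu : Coupled (loopSpace G N) (G.u t) (N.u t) := by
          rw [show G.u t = _ from funext (G.control t), show N.u t = _ from funext (N.control t)]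
          exact (hxhat.stack (ih t le_rfl).sndBlock).act S.K
        rw [show G.x (t + 1) = _ from funext (G.plant t),
          show N.x (t + 1) = _ from funext (N.plant t)]
        exact (((ih t le_rfl).act S.A).add (hu.act S.B)).add (hw t)
  exact ⟨hall t t le_rfl, hxtil t (hall t) fun k hk => hyy k (hall t k hk.le),
    hyy t (hall t t le_rfl)⟩

end

/-! ### Centred Gaussian vectors -/

section
variable {Ω : Type*} [MeasurableSpace Ω] {P : Measure Ω} {ι : Type} [Fintype ι]

/-- The matrix of second moments of a random vector. -/
noncomputable def secondMoment (P : Measure Ω) (X : Ω → Vec ι) : Matrix ι ι ℝ :=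
  Matrix.of fun i j => ∫ ω, X ω i * X ω j ∂P

lemma dotProduct_secondMoment_mulVec {X : Ω → Vec ι} (hX : ∀ i, MemLp (fun ω => X ω i) 2 P)
    (a : ι → ℝ) : a ⬝ᵥ (secondMoment P X).mulVec a = ∫ ω, (∑ i, a i * X ω i) ^ 2 ∂P := by
  have hexp : ∀ ω, (∑ i, a i * X ω i) ^ 2 = ∑ i, ∑ j, a i * a j * (X ω i * X ω j) := by
    intro ω
    rw [pow_two, Finset.sum_mul_sum]
    exact Finset.sum_congr rfl fun i _ => Finset.sum_congr rfl fun j _ => by ring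
  have hint : ∀ i j, Integrable (fun ω => a i * a j * (X ω i * X ω j)) P := fun i j =>
    ((hX i).integrable_mul (hX j)).const_mul _
  simp_rw [hexp]
  rw [integral_finsetSum _ fun i _ => integrable_finsetSum _ fun j _ => hint i j]
  simp only [dotProduct, Matrix.mulVec, secondMoment, Matrix.of_apply, Finset.mul_sum]
  refine Finset.sum_congr rfl fun i _ => ?_
  rw [integral_finsetSum _ fun j _ => hint i j]
  refine Finset.sum_congr rfl fun j _ => ?_
  rw [integral_const_mul]
  ring

lemma posSemidef_secondMoment {X : Ω → Vec ι} (hX : ∀ i, MemLp (fun ω => X ω i) 2 P) :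
    (secondMoment P X).PosSemidef := by
  refine Matrix.PosSemidef.of_dotProduct_mulVec_nonneg ?_ fun a => ?_
  · ext i j
    simp [secondMoment, mul_comm]
  · rw [star_trivial, dotProduct_secondMoment_mulVec hX]
    exact integral_nonneg fun _ => sq_nonneg _

variable [DecidableEq ι]

/-- The second moment matrix of a signal plus orthogonal white noise is positive definite, even if
that of the signal is singular. -/
lemma posDef_secondMoment_add {X V : Ω → Vec ι} (hX : ∀ i, MemLp (fun ω => X ω i) 2 P)
    (hV : ∀ i, MemLp (fun ω => V ω i) 2 P)
    (hVV : ∀ i j, ∫ ω, V ω i * V ω j ∂P = if i = j then 1 else 0)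
    (hXV : ∀ i j, ∫ ω, X ω i * V ω j ∂P = 0) :
    (secondMoment P fun ω => X ω + V ω).PosDef := by
  have h : (secondMoment P fun ω => X ω + V ω) = 1 + secondMoment P X := by
    ext i j
    have h1 : ∀ ω, (X ω + V ω) i * (X ω + V ω) j =
        (X ω i * X ω j + X ω i * V ω j) + (X ω j * V ω i + V ω i * V ω j) := fun ω => by
      simp only [PiLp.add_apply]; ring
    have i1 : Integrable (fun ω => X ω i * X ω j) P := (hX i).integrable_mul (hX j)
    have i2 : Integrable (fun ω => X ω i * V ω j) P := (hX i).integrable_mul (hV j)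
    have i3 : Integrable (fun ω => X ω j * V ω i) P := (hX j).integrable_mul (hV i)
    have i4 : Integrable (fun ω => V ω i * V ω j) P := (hV i).integrable_mul (hV j)
    have i5 : Integrable (fun ω => X ω i * X ω j + X ω i * V ω j) P := i1.add i2
    have i6 : Integrable (fun ω => X ω j * V ω i + V ω i * V ω j) P := i3.add i4
    simp only [secondMoment, Matrix.of_apply, Matrix.add_apply, h1]
    rw [integral_add i5 i6, integral_add i1 i2, integral_add i3 i4, hXV, hXV, hVV,
      Matrix.one_apply]
    ring
  rw [h]
  exact Matrix.PosDef.one.add_posSemidef (posSemidef_secondMoment hX)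

/-- A centred Gaussian vector is determined in law by its second moments. -/
lemma map_eq_multivariateGaussian [IsProbabilityMeasure P] {Y : Ω → Vec ι}
    (hY : HasGaussianLaw Y P) (hmean : ∀ i, ∫ ω, Y ω i ∂P = 0) :
    P.map Y = multivariateGaussian 0 (secondMoment P Y) := by
  have hY2 : ∀ i, MemLp (fun ω => Y ω i) 2 P := fun i => (hY.coord i).memLp_two
  have := Measure.isProbabilityMeasure_map (μ := P) hY.aemeasurable
  refine Measure.ext_of_charFun ?_
  ext a
  have hin : ∀ ω, inner ℝ a (Y ω) = ∑ i, a i * Y ω i := fun ω => by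
    simp [PiLp.inner_apply, mul_comm]
  have hm : ∫ ω, inner ℝ a (Y ω) ∂P = 0 := by
    simp_rw [hin]
    rw [integral_finsetSum _ fun i _ => ((hY2 i).integrable one_le_two).const_mul _]
    simp [integral_const_mul, hmean]
  have hv : Var[fun ω => inner ℝ a (Y ω); P] =
      (WithLp.ofLp a) ⬝ᵥ (secondMoment P Y).mulVec (WithLp.ofLp a) := by
    rw [variance_of_integral_eq_zero (hY.aemeasurable.const_inner) hm,
      dotProduct_secondMoment_mulVec hY2]
    simp_rw [hin]
  rw [hY.charFun_map_eq, charFun_multivariateGaussian (posSemidef_secondMoment hY2), hm, hv]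
  simp

open scoped MatrixOrder in
/-- A nondegenerate centred Gaussian measure is a linear image of the standard one. -/
lemma exists_map_stdGaussian_eq {W : Matrix ι ι ℝ} (hW : W.PosDef) :
    ∃ L : Vec ι ≃L[ℝ] Vec ι, multivariateGaussian 0 W = (stdGaussian (Vec ι)).map L := by
  have hu : IsUnit (CFC.sqrt W) :=
    (CFC.isUnit_sqrt_iff W hW.posSemidef.nonneg).2 hW.isUnit
  obtain ⟨U, hU⟩ := hu.map (Matrix.toEuclideanCLM (n := ι) (𝕜 := ℝ))
  refine ⟨ContinuousLinearEquiv.unitsEquiv ℝ (Vec ι) U, ?_⟩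
  rw [multivariateGaussian]
  congr 1
  ext1 u
  rw [zero_add, ContinuousLinearEquiv.unitsEquiv_apply, hU]

end

section
variable {Ω Ω' : Type*} [MeasurableSpace Ω] [MeasurableSpace Ω'] {P : Measure Ω} {P' : Measure Ω'}
  {V : Submodule ℝ ((Ω → ℝ) × (Ω' → ℝ))}

lemma IsCoupledSpace.hasGaussianLaw (hV : IsCoupledSpace P P' V) {ι : Type} [Fintype ι]
    {X : Ω → Vec ι} {X' : Ω' → Vec ι} (hX : Coupled V X X') : HasGaussianLaw X P := by
  classical
  refine hasGaussianLaw_of_forall_dual ?_ fun L => ?_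
  · have h : AEMeasurable (fun ω i => X ω i) P :=
      aemeasurable_pi_lambda _ fun i => (hV.gaussian _ (hX i)).aemeasurable
    exact (WithLp.measurable_toLp 2 _).comp_aemeasurable h
  · have h : (fun ω => L (X ω)) =
        (∑ i, L (EuclideanSpace.single i 1) • ((fun ω => X ω i, fun ω => X' ω i) :
          (Ω → ℝ) × (Ω' → ℝ))).1 := by
      ext ω
      have hdec : X ω = ∑ i, X ω i • EuclideanSpace.single i (1 : ℝ) := by
        ext j
        simp [Pi.single_apply, Finset.sum_apply]
      rw [hdec, map_sum]
      simp [Prod.fst_sum, Finset.sum_apply, mul_comm]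
    rw [h]
    exact hV.gaussian _ (V.sum_mem fun i _ => V.smul_mem _ (hX i))

lemma IsCoupledSpace.integral_sq_norm (hV : IsCoupledSpace P P' V) {ι : Type} [Fintype ι]
    {X : Ω → Vec ι} {X' : Ω' → Vec ι} (hX : Coupled V X X') :
    Integrable (fun ω => ‖X' ω‖ ^ 2) P' ∧ ∫ ω, ‖X' ω‖ ^ 2 ∂P' = ∫ ω, ‖X ω‖ ^ 2 ∂P := by
  simp_rw [EuclideanSpace.real_norm_sq_eq]
  have h1 : ∀ i, Integrable (fun ω => X' ω i ^ 2) P' := fun i => (hV.memLp _ (hX i)).integrable_sq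
  have h2 : ∀ i, Integrable (fun ω => X ω i ^ 2) P := fun i =>
    (hV.memLp_fst (hX i)).integrable_sq
  refine ⟨integrable_finsetSum _ fun i _ => h1 i, ?_⟩
  rw [integral_finsetSum _ fun i _ => h1 i, integral_finsetSum _ fun i _ => h2 i]
  refine Finset.sum_congr rfl fun i _ => ?_
  simp_rw [pow_two]
  exact (hV.moments _ (hX i) _ (hX i)).symm

end

/-- The constants of the entropy bound. With `T = |det L|`, the left side is the differential
entropy of `N(0, L Lᵀ)` less `n log Δ`, in nats. For `Δ² = 12` it equals
`(n / 2) log (2 π e / 12) + log T`, so that the constant `4 π e / 12` leaves `n / 2` bits to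
spare. -/
lemma neg_log_density_le (n : ℕ) {T : ℝ} (hT : 0 < T) :
    -Real.log (sens ^ n * ((2 * Real.pi) ^ (n / 2 : ℝ))⁻¹ * T⁻¹) + n / 2 ≤
      Real.log 2 * ((n : ℝ) / 2 * Real.logb 2 (4 * Real.pi * Real.exp 1 / 12)) + Real.log T := by
  have hs := sens_pos
  have h2 : (0 : ℝ) < Real.log 2 := Real.log_pos one_lt_two
  have hls : 2 * Real.log sens = Real.log 12 := by
    rw [← sens_sq, Real.log_pow]; norm_num
  have e1 : Real.log (sens ^ n * ((2 * Real.pi) ^ (n / 2 : ℝ))⁻¹ * T⁻¹) =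
      n * Real.log sens - n / 2 * Real.log (2 * Real.pi) - Real.log T := by
    rw [Real.log_mul (by positivity) (by positivity), Real.log_mul (by positivity) (by positivity),
      Real.log_inv, Real.log_inv, Real.log_pow, Real.log_rpow (by positivity)]
    ring
  have e2 : Real.log 2 * ((n : ℝ) / 2 * Real.logb 2 (4 * Real.pi * Real.exp 1 / 12)) =
      n / 2 * (Real.log 2 + Real.log (2 * Real.pi) + 1 - Real.log 12) := by
    have : 4 * Real.pi * Real.exp 1 / 12 = 2 * (2 * Real.pi) * Real.exp 1 / 12 := by ring
    rw [Real.logb, this, Real.log_div (by positivity) (by norm_num),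
      Real.log_mul (by positivity) (by positivity), Real.log_mul (by norm_num) (by positivity),
      Real.log_exp]
    field_simp
  rw [e1, e2, ← hls]
  have : 0 ≤ (n : ℝ) / 2 * Real.log 2 := by positivity
  nlinarith

end DitheredLQG

open DitheredLQG in
theorem lemma2 {n m p : ℕ} (S : DitheredLQG.System n m p)
    {Ω : Type*} [MeasurableSpace Ω] (P : Measure Ω) [IsProbabilityMeasure P]
    {Ω' : Type*} [MeasurableSpace Ω'] (P' : Measure Ω') [IsProbabilityMeasure P']
    (G : DitheredLQG.GaussianLoop S P) (N : DitheredLQG.DitheredLoop S P')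
    (first_moments : ∀ i, ∫ ω, N.x 0 ω i ∂P' = ∫ ω, G.x 0 ω i ∂P)
    (second_moments : ∀ i j,
      ∫ ω, N.x 0 ω i * N.x 0 ω j ∂P' = ∫ ω, G.x 0 ω i * G.x 0 ω j ∂P)
    (t : ℕ) :
    DitheredLQG.condEntropyBits (N.ztil t) (N.d t) P' ≤
      ENNReal.ofReal ((n : ℝ) / 2 * Real.logb 2 (4 * Real.pi * Real.exp 1 / 12)) +
        DitheredLQG.mutualInfoBits
          (fun ω => DitheredLQG.act S.C₁ (G.rtil t ω))
          (fun ω => DitheredLQG.act S.C₁ (G.rtil t ω) + G.v t ω) P := by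
  have hV := isCoupledSpace_loopSpace (G := G) (N := N) first_moments second_moments
  obtain ⟨hx, hxtil, -⟩ := coupled_loops hV t
  have hr : Coupled (loopSpace G N) (G.rtil t) fun ω => fstBlock (N.x t ω) - N.xtil t ω :=
    hx.fstBlock.sub hxtil
  have hv : Coupled (loopSpace G N) (G.v t) (N.noise t) := fun i =>
    Submodule.subset_span (Or.inl (Or.inr ⟨(t, i), rfl⟩))
  have hX : Coupled (loopSpace G N) (fun ω => act S.C₁ (G.rtil t ω)) (N.input t) := hr.act S.C₁
  have hY : Coupled (loopSpace G N) (fun ω => act S.C₁ (G.rtil t ω) + G.v t ω) (N.y t) := by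
    rw [show N.y t = _ from funext (N.y_eq t)]
    exact hX.add hv
  have hXm : Measurable fun ω => act S.C₁ (G.rtil t ω) := measurable_act (G.measurable_rtil t)
  have hYm : Measurable fun ω => act S.C₁ (G.rtil t ω) + G.v t ω := hXm.add (G.measurable_v t)
  -- mean zero: the constants are among the data of the linear estimate
  have hmean : ∀ i, ∫ ω, (act S.C₁ (G.rtil t ω) + G.v t ω) i ∂P = 0 := by
    have hr0 : ∀ j, ∫ ω, G.rtil t ω j ∂P = 0 := by
      intro j
      have h1 := (N.prior t).integral_mul_eq_zero (φ := AffineMap.const ℝ _ 1)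
        (fun i => hV.memLp _ (hx.fstBlock i)) (fun i => hV.memLp _ (hxtil i)) (memLp_const 1) j
      have h2 := hV.moments _ (hr j) _ hV.one_mem
      simp only [Pi.one_apply, mul_one] at h2
      rw [h2]
      simpa using h1
    intro i
    have hi : ∀ j, Integrable (fun ω => S.C₁ i j * G.rtil t ω j) P := fun j =>
      ((hV.memLp_fst (hr j)).integrable one_le_two).const_mul _
    simp only [PiLp.add_apply, act_apply]
    rw [integral_add (integrable_finsetSum _ fun j _ => hi j)
      ((hV.memLp_fst (hv i)).integrable one_le_two), integral_finsetSum _ fun j _ => hi j,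
      integral_coord_multivariateGaussian (G.law_v t)]
    simp [integral_const_mul, hr0]
  have hvv : ∀ i j, ∫ ω, G.v t ω i * G.v t ω j ∂P = if i = j then 1 else 0 := by
    intro i j
    rw [integral_noise_mul_noise G.law_v G.indep_v, if_pos rfl, multivariateGaussian_zero_one,
      integral_coord_mul_coord_stdGaussian]
  have hpos := posDef_secondMoment_add (fun i => hV.memLp_fst (hX i))
    (fun i => hV.memLp_fst (hv i)) hvv fun i j => by
      rw [hV.moments _ (hX i) _ (hv j)]
      simpa only [mul_comm] using
        N.integral_noise_mul_input t j i ((hV.memLp _ (hX i)).integrable one_le_two)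
  obtain ⟨L, hL⟩ := exists_map_stdGaussian_eq hpos
  have hlaw := (map_eq_multivariateGaussian (hV.hasGaussianLaw hY) hmean).trans hL
  set T : ℝ := |LinearMap.det (L : Vec (Fin n) →ₗ[ℝ] Vec (Fin n))| with hT
  have hTpos : 0 < T := abs_pos.2 (LinearEquiv.isUnit_det' L.toLinearEquiv).ne_zero
  have hlog : 0 < Real.log 2 := Real.log_pos one_lt_two
  have hlog0 : ENNReal.ofReal (Real.log 2) ≠ 0 := by simpa using hlog
  -- mutual information of the Gaussian loop
  have hmi : ENNReal.ofReal (Real.log T) / ENNReal.ofReal (Real.log 2) ≤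
      mutualInfoBits (fun ω => act S.C₁ (G.rtil t ω))
        (fun ω => act S.C₁ (G.rtil t ω) + G.v t ω) P := by
    have hv2 : ∀ i, Integrable (fun ω => G.v t ω i ^ 2) P := fun i =>
      (hV.memLp_fst (hv i)).integrable_sq
    refine ENNReal.div_le_div_right (log_det_le_klDiv hXm hYm L hlaw ?_ ?_) _
    · simp_rw [add_sub_cancel_left, EuclideanSpace.real_norm_sq_eq]
      exact integrable_finsetSum _ fun i _ => hv2 i
    · simp_rw [add_sub_cancel_left, EuclideanSpace.real_norm_sq_eq]
      rw [integral_finsetSum _ fun i _ => hv2 i]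
      simp [pow_two, hvv]
  -- entropy of the quantizer output
  have hent := condEntropyBits_le (N.measurable_ztil t) (N.measurable_d t) sens_pos
    (fun ω => by rw [N.quantizer]; exact quantize_mem_quantLattice _ _)
    (map_eq_smul_volume_restrict_ditherCube (N.measurable_d t) sens_pos (N.law_d t)
      (N.indep_d.precomp (g := fun i => (t, i)) (Prod.mk_right_injective t))) L
  simp_rw [← N.decoder] at hent
  have hsec := hV.integral_sq_norm
    (hY.continuousLinearMap (L.symm : Vec (Fin n) →L[ℝ] Vec (Fin n)))
  have hent' := hent hsec.1 (hsec.2.trans (integral_sq_norm_whitened hYm L hlaw).2)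
  rw [Fintype.card_fin] at hent'
  have hfin := hent'.trans (ENNReal.ofReal_le_ofReal (neg_log_density_le n hTpos))
  refine le_trans ?_ (add_le_add_right hmi _)
  rw [← ENNReal.mul_le_mul_iff_right hlog0 ENNReal.ofReal_ne_top, mul_add,
    ENNReal.mul_div_cancel hlog0 ENNReal.ofReal_ne_top, ← ENNReal.ofReal_mul hlog.le]
  exact hfin.trans ENNReal.ofReal_add_le
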